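/- Let $M$ be a smooth (finite-dimensional, boundaryless) manifold and let $n\ge 0$ be an integer. Let $\mathcal T^n = TM\oplus\wedge^nT^*M$, let $\rho:\mathcal T^n\to TM$ be the projection, and write sections of $\mathcal T^n$ as $X+\alpha$ with $X\in\mathfrak X(M)$, $\alpha\in\Omega^n(M)$. Define the $\wedge^{n-1}T^*M$-valued pairing and the higher-order Dorfman bracket by $$\langle X+\alpha,Y+\beta\rangle=\tfrac12\,(i_X\beta+i_Y\alpha),\qquad [X+\alpha,Y+\beta]=[X,Y]+L_X\beta-L_Y\alpha+d\,i_Y\alpha,$$ where $\wedge^{-1}T^*M=0$, so that interior products of $0$-forms vanish. A Leibniz algebroid structure on a smooth vector bundle $V\to M$ consists of an $\mathbb R$-bilinear bracket on the space $\Gamma(V)$ of smooth sections satisfying $[s_1,[s_2,s_3]]=[[s_1,s_2],s_3]+[s_2,[s_1,s_3]]$, and a smooth vector bundle morphism $a:V\to TM$ (the anchor), such that $a[s_1,s_2]=[a(s_1),a(s_2)]$ and $[s_1,fs_2]=f[s_1,s_2]+a(s_1)(f)\,s_2$ for all $s_1,s_2,s_3\in\Gamma(V)$ and $f\in C^\infty(M)$.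 Then the following hold for all $e_1,e_2,e_3\in\Gamma(\mathcal T^n)$ and $f\in C^\infty(M)$. (1) $$[e_1,fe_2]=f[e_1,e_2]+\rho(e_1)(f)\,e_2,\qquad [fe_1,e_2]=f[e_1,e_2]-\rho(e_2)(f)\,e_1+df\wedge 2\langle e_1,e_2\rangle .$$ (2) $$[e_1,[e_2,e_3]]=[[e_1,e_2],e_3]+[e_2,[e_1,e_3]],$$ and $(\mathcal T^n,[\cdot,\cdot],\rho)$ is a Leibniz algebroid. (3) $$L_{\rho(e_1)}\langle e_2,e_3\rangle=\langle[e_1,e_2],e_3\rangle+\langle e_2,[e_1,e_3]\rangle .$$ -/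

import Mathlib

open Bundle VectorField
open scoped Manifold ContDiff

noncomputable section

namespace HigherDorfman

/-! ### The bundle of alternating `n`-forms on the tangent spaces of a manifold -/

section AltBundle

universe u v
variable {E : Type u} [NormedAddCommGroup E] [NormedSpace ℝ E]
  {M : Type v} [TopologicalSpace M] [ChartedSpace E M]

/-- Left inverse of the inclusion of alternating maps into multilinear maps (antisymmetrisation
divided by `n!`); it is only used to see that pullback of alternating forms is smooth. -/
def altProj (E : Type u) [NormedAddCommGroup E] [NormedSpace ℝ E] (n : ℕ) :
    ContinuousMultilinearMap ℝ (fun _ : Fin n => E) ℝ →L[ℝ] (E [⋀^Fin n]→L[ℝ] ℝ) :=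
  LinearMap.mkContinuous
    { toFun := fun f => ((n.factorial : ℝ)⁻¹) • ContinuousMultilinearMap.alternatization f
      map_add' := fun f g => by simp
      map_smul' := fun c f => by
        ext v
        simp only [ContinuousAlternatingMap.smul_apply,
          ContinuousMultilinearMap.alternatization_apply_apply,
          smul_apply, RingHom.id_apply, smul_eq_mul]
        rw [mul_left_comm, Finset.mul_sum (a := c)]
        congr 1
        refine Finset.sum_congr rfl fun σ _ => ?_
        rw [Units.smul_def, Units.smul_def, zsmul_eq_mul, zsmul_eq_mul]
        ring }
    1 (fun f => by
      refine ContinuousAlternatingMap.opNorm_le_bound _ (by positivity) fun v => ?_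
      simp only [LinearMap.coe_mk, AddHom.coe_mk, ContinuousAlternatingMap.smul_apply,
        ContinuousMultilinearMap.alternatization_apply_apply, norm_smul, norm_inv, Real.norm_natCast]
      have h : ‖∑ σ : Equiv.Perm (Fin n), Equiv.Perm.sign σ • f (v ∘ σ)‖
          ≤ (n.factorial : ℝ) * (‖f‖ * ∏ i, ‖v i‖) := by
        refine (norm_sum_le _ _).trans ?_
        refine (Finset.sum_le_card_nsmul _ _ (‖f‖ * ∏ i, ‖v i‖) fun σ _ => ?_).trans ?_
        · have h1 : ‖Equiv.Perm.sign σ • f (v ∘ σ)‖ = ‖f (v ∘ σ)‖ := by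
            rcases Int.units_eq_one_or (Equiv.Perm.sign σ) with h | h <;> simp [h]
          rw [h1]
          refine (f.le_opNorm _).trans_eq ?_
          congr 1
          exact Equiv.prod_comp σ fun i => ‖v i‖
        · simp [Fintype.card_perm]
      have hn : (0 : ℝ) < n.factorial := by exact_mod_cast n.factorial_pos
      rw [one_mul, inv_mul_le_iff₀ hn]
      exact h)

theorem altProj_coe (n : ℕ) (f : E [⋀^Fin n]→L[ℝ] ℝ) :
    altProj E n f.toContinuousMultilinearMap = f := by
  have hn : (n.factorial : ℝ) ≠ 0 := by exact_mod_cast n.factorial_ne_zero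
  ext v
  change (n.factorial : ℝ)⁻¹ • (ContinuousMultilinearMap.alternatization
    f.toContinuousMultilinearMap) v = f v
  rw [ContinuousMultilinearMap.alternatization_apply_apply]
  have h : ∀ σ : Equiv.Perm (Fin n),
      Equiv.Perm.sign σ • f.toContinuousMultilinearMap (v ∘ σ) = f v := fun σ => by
    change Equiv.Perm.sign σ • f (v ∘ σ) = f v
    have h1 : f (v ∘ σ) = Equiv.Perm.sign σ • f v := f.toAlternatingMap.map_perm v σ
    rw [h1, smul_smul, Int.units_mul_self, one_smul]
  rw [Finset.sum_congr rfl fun σ _ => h σ]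
  simp [Fintype.card_perm, hn]

theorem contDiff_compContinuousLinearMapCLM (n : ℕ) :
    ContDiff ℝ ∞ (fun g : E →L[ℝ] E =>
      (ContinuousAlternatingMap.compContinuousLinearMapCLM g :
        (E [⋀^Fin n]→L[ℝ] ℝ) →L[ℝ] (E [⋀^Fin n]→L[ℝ] ℝ))) := by
  have h : (fun g : E →L[ℝ] E =>
      (ContinuousAlternatingMap.compContinuousLinearMapCLM g :
        (E [⋀^Fin n]→L[ℝ] ℝ) →L[ℝ] (E [⋀^Fin n]→L[ℝ] ℝ))) = fun g =>
      ((altProj E n).comp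
        (ContinuousMultilinearMap.compContinuousLinearMapContinuousMultilinear ℝ
          (fun _ : Fin n => E) (fun _ => E) ℝ (fun _ => g))).comp
        (ContinuousAlternatingMap.toContinuousMultilinearMapCLM ℝ) := by
    funext g
    refine ContinuousLinearMap.ext fun η => ?_
    exact (altProj_coe n (η.compContinuousLinearMap g)).symm
  rw [h]
  refine ContDiff.clm_comp (contDiff_const.clm_comp ?_) contDiff_const
  exact (ContinuousMultilinearMap.contDiff _).comp (contDiff_pi.2 fun _ => contDiff_id)

variable (E M) in
/-- The bundle `∧ⁿ T*M`, with transition maps the pullbacks of alternating forms along the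
transition maps of the tangent bundle. -/
def extCotangentCore [IsManifold 𝓘(ℝ, E) ∞ M] (n : ℕ) :
    VectorBundleCore ℝ M (E [⋀^Fin n]→L[ℝ] ℝ) (atlas E M) where
  baseSet i := i.1.source
  isOpen_baseSet i := i.1.open_source
  indexAt := achart E
  mem_baseSet_at := mem_chart_source E
  coordChange i j x := ContinuousAlternatingMap.compContinuousLinearMapCLM
    ((tangentBundleCore 𝓘(ℝ, E) M).coordChange j i x)
  coordChange_self i x hx η := by
    ext v
    exact congrArg η (funext fun k =>
      (tangentBundleCore 𝓘(ℝ, E) M).coordChange_self i x hx (v k))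
  continuousOn_coordChange i j :=
    ContinuousAlternatingMap.continuous_compContinuousLinearMapCLM.comp_continuousOn
      (((tangentBundleCore 𝓘(ℝ, E) M).continuousOn_coordChange j i).mono
        (fun _ hx => ⟨hx.2, hx.1⟩))
  coordChange_comp i j k x hx η := by
    ext v
    exact congrArg η (funext fun l =>
      (tangentBundleCore 𝓘(ℝ, E) M).coordChange_comp k j i x ⟨⟨hx.2, hx.1.2⟩, hx.1.1⟩ (v l))

instance extCotangentCore_isContMDiff [IsManifold 𝓘(ℝ, E) ∞ M] (n : ℕ) :
    (extCotangentCore E M n).IsContMDiff 𝓘(ℝ, E) ∞ where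
  contMDiffOn_coordChange i j := by
    have h1 : IsManifold 𝓘(ℝ, E) (∞ + 1) M := ‹IsManifold 𝓘(ℝ, E) ∞ M›
    have h2 : (tangentBundleCore 𝓘(ℝ, E) M).IsContMDiff 𝓘(ℝ, E) ∞ :=
      tangentBundleCore.isContMDiff
    exact (contDiff_compContinuousLinearMapCLM n).contMDiff.comp_contMDiffOn
      ((h2.contMDiffOn_coordChange j i).mono (fun _ hx => ⟨hx.2, hx.1⟩))

variable (E) in
/-- The fiber `∧ⁿ T*ₓM`: alternating `n`-linear forms on the tangent space at `x`. -/
def ExtCotangent (n : ℕ) (x : M) : Type u := TangentSpace 𝓘(ℝ, E) x [⋀^Fin n]→L[ℝ] ℝ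

instance (n : ℕ) (x : M) : AddCommGroup (ExtCotangent E n x) :=
  inferInstanceAs (AddCommGroup (E [⋀^Fin n]→L[ℝ] ℝ))
instance (n : ℕ) (x : M) : Module ℝ (ExtCotangent E n x) :=
  inferInstanceAs (Module ℝ (E [⋀^Fin n]→L[ℝ] ℝ))
instance (n : ℕ) (x : M) : TopologicalSpace (ExtCotangent E n x) :=
  inferInstanceAs (TopologicalSpace (E [⋀^Fin n]→L[ℝ] ℝ))
instance (n : ℕ) (x : M) : IsTopologicalAddGroup (ExtCotangent E n x) :=
  inferInstanceAs (IsTopologicalAddGroup (E [⋀^Fin n]→L[ℝ] ℝ))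
instance (n : ℕ) (x : M) : ContinuousSMul ℝ (ExtCotangent E n x) :=
  inferInstanceAs (ContinuousSMul ℝ (E [⋀^Fin n]→L[ℝ] ℝ))

variable [IsManifold 𝓘(ℝ, E) ∞ M]

instance (n : ℕ) :
    TopologicalSpace (TotalSpace (E [⋀^Fin n]→L[ℝ] ℝ) (ExtCotangent E n : M → Type u)) :=
  inferInstanceAs (TopologicalSpace (extCotangentCore E M n).TotalSpace)
instance (n : ℕ) : FiberBundle (E [⋀^Fin n]→L[ℝ] ℝ) (ExtCotangent E n : M → Type u) :=
  (extCotangentCore E M n).fiberBundle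
instance (n : ℕ) : VectorBundle ℝ (E [⋀^Fin n]→L[ℝ] ℝ) (ExtCotangent E n : M → Type u) :=
  (extCotangentCore E M n).vectorBundle
instance (n : ℕ) :
    ContMDiffVectorBundle ∞ (E [⋀^Fin n]→L[ℝ] ℝ) (ExtCotangent E n : M → Type u) 𝓘(ℝ, E) :=
  (extCotangentCore E M n).instContMDiffVectorBundle

end AltBundle

/-! ### Cartan calculus

A vector field is a function `X : Π x : M, TangentSpace 𝓘(ℝ, E) x`, an `n`-form is a function
`η : Π x : M, ExtCotangent E n x`; smoothness is imposed separately. -/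

section Calculus

universe u v
variable {E : Type u} [NormedAddCommGroup E] [NormedSpace ℝ E]
  {M : Type v} [TopologicalSpace M] [ChartedSpace E M]

/-- The expression of the form `η` in the preferred chart at `x₀`, i.e. its pullback along the
inverse of that chart. -/
def chartForm {n : ℕ} (η : Π x : M, ExtCotangent E n x) (x₀ : M) (y : E) : E [⋀^Fin n]→L[ℝ] ℝ :=
  (show E [⋀^Fin n]→L[ℝ] ℝ from η ((extChartAt 𝓘(ℝ, E) x₀).symm y)).compContinuousLinearMap
    (show E →L[ℝ] E from mfderiv 𝓘(ℝ, E) 𝓘(ℝ, E) (extChartAt 𝓘(ℝ, E) x₀).symm y)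

/-- The expression of the vector field `X` in the preferred chart at `x₀`. -/
def chartField (X : Π x : M, TangentSpace 𝓘(ℝ, E) x) (x₀ : M) (y : E) : E :=
  mpullback 𝓘(ℝ, E) 𝓘(ℝ, E) (extChartAt 𝓘(ℝ, E) x₀).symm X y

/-- Transport of a form at `x`, expressed in the preferred chart at `x`, back to `M`. -/
def ofChart {n : ℕ} (x : M) (η : E [⋀^Fin n]→L[ℝ] ℝ) : ExtCotangent E n x :=
  η.compContinuousLinearMap
    (show E →L[ℝ] E from mfderiv 𝓘(ℝ, E) 𝓘(ℝ, E) (extChartAt 𝓘(ℝ, E) x) x)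

/-- The exterior derivative `dη`, computed at `x` in the preferred chart at `x`. -/
def extDer {n : ℕ} (η : Π x : M, ExtCotangent E n x) : Π x : M, ExtCotangent E (n + 1) x :=
  fun x => ofChart x (extDeriv (chartForm η x) (extChartAt 𝓘(ℝ, E) x x))

/-- The Lie derivative of a form on the vector space `E`:
`(L_X η)(v₁, …, vₙ) = (D_X η)(v₁, …, vₙ) + ∑ i, η(v₁, …, DX(vᵢ), …, vₙ)`. -/
def lieDerVec {n : ℕ} (X : E → E) (η : E → E [⋀^Fin n]→L[ℝ] ℝ) (y : E) : E [⋀^Fin n]→L[ℝ] ℝ :=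
  fderiv ℝ η y (X y) +
    (η y).fderivCompContinuousLinearMap (ContinuousLinearMap.id ℝ E) (fderiv ℝ X y)

theorem lieDerVec_apply {n : ℕ} (X : E → E) (η : E → E [⋀^Fin n]→L[ℝ] ℝ) (y : E)
    (v : Fin n → E) :
    lieDerVec X η y v = fderiv ℝ η y (X y) v +
      ∑ i, η y (Function.update v i (fderiv ℝ X y (v i))) := by
  rw [lieDerVec, ContinuousAlternatingMap.add_apply,
    ContinuousAlternatingMap.fderivCompContinuousLinearMap_apply]
  congr 1
  refine Finset.sum_congr rfl fun i _ => congrArg _ (funext fun j => ?_)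
  rcases eq_or_ne j i with rfl | h
  · simp
  · simp [h]

/-- The Lie derivative `L_X η`, computed at `x` in the preferred chart at `x`. -/
def lieDer {n : ℕ} (X : Π x : M, TangentSpace 𝓘(ℝ, E) x) (η : Π x : M, ExtCotangent E n x) :
    Π x : M, ExtCotangent E n x :=
  fun x => ofChart x (lieDerVec (chartField X x) (chartForm η x) (extChartAt 𝓘(ℝ, E) x x))

/-- The derivative `X(f)` of a function along a vector field. -/
def derivAlong (X : Π x : M, TangentSpace 𝓘(ℝ, E) x) (f : M → ℝ) (x : M) : ℝ :=
  mfderiv 𝓘(ℝ, E) 𝓘(ℝ, ℝ) f x (X x)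

variable (E) in
/-- The fiber of `∧ⁿ⁻¹ T*M`, where `∧⁻¹ T*M` is the zero bundle. -/
def ExtCotangentPred : (n : ℕ) → (x : M) → Type u
  | 0, _ => PUnit.{u + 1}
  | n + 1, x => ExtCotangent E n x

instance : (n : ℕ) → (x : M) → AddCommGroup (ExtCotangentPred E n x)
  | 0, _ => inferInstanceAs (AddCommGroup PUnit.{u + 1})
  | n + 1, x => inferInstanceAs (AddCommGroup (ExtCotangent E n x))

instance : (n : ℕ) → (x : M) → Module ℝ (ExtCotangentPred E n x)
  | 0, _ => inferInstanceAs (Module ℝ PUnit.{u + 1})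
  | n + 1, x => inferInstanceAs (Module ℝ (ExtCotangent E n x))

/-- The interior product `i_X η = η(X, ·, …, ·)`, which vanishes on `0`-forms. -/
def interior : {n : ℕ} → (X : Π x : M, TangentSpace 𝓘(ℝ, E) x) →
    (η : Π x : M, ExtCotangent E n x) → Π x : M, ExtCotangentPred E n x
  | 0, _, _, _ => PUnit.unit
  | n + 1, X, η, x => ContinuousAlternatingMap.curryLeft (E := E) (n := n) (show E [⋀^Fin (n + 1)]→L[ℝ] ℝ from η x) (X x)

/-- The exterior derivative on `(n-1)`-forms. -/
def extDerPred : {n : ℕ} → (Π x : M, ExtCotangentPred E n x) → Π x : M, ExtCotangent E n x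
  | 0, _ => 0
  | n + 1, ξ => extDer (n := n) ξ

/-- The Lie derivative on `(n-1)`-forms. -/
def lieDerPred : {n : ℕ} → (X : Π x : M, TangentSpace 𝓘(ℝ, E) x) →
    (Π x : M, ExtCotangentPred E n x) → Π x : M, ExtCotangentPred E n x
  | 0, _, _, _ => PUnit.unit
  | n + 1, X, ξ, x => lieDer (n := n) X ξ x

/-- The wedge product `df ∧ ξ` of the differential of a function with an `(n-1)`-form:
`(df ∧ ξ)(v₁, …, vₙ) = ∑ i, (-1) ^ (i - 1) * df(vᵢ) * ξ(v₁, …, v̂ᵢ, …, vₙ)`. -/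
def dWedgePred : {n : ℕ} → (f : M → ℝ) → (Π x : M, ExtCotangentPred E n x) →
    Π x : M, ExtCotangent E n x
  | 0, _, _ => 0
  | n + 1, f, ξ => fun x => ContinuousAlternatingMap.alternatizeUncurryFin (E := E) (n := n)
      ((show E →L[ℝ] ℝ from mfderiv 𝓘(ℝ, E) 𝓘(ℝ, ℝ) f x).smulRight
        (show E [⋀^Fin n]→L[ℝ] ℝ from ξ x))

end Calculus

/-! ### Leibniz algebroids -/

section Algebroid

universe u v
variable {E : Type u} [NormedAddCommGroup E] [NormedSpace ℝ E]
  {M : Type v} [TopologicalSpace M] [ChartedSpace E M] [IsManifold 𝓘(ℝ, E) ∞ M]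
  (F : Type*) [NormedAddCommGroup F] [NormedSpace ℝ F]
  {V : M → Type*} [TopologicalSpace (TotalSpace F V)]
  [∀ x, AddCommGroup (V x)] [∀ x, Module ℝ (V x)] [∀ x, TopologicalSpace (V x)]
  [FiberBundle F V] [VectorBundle ℝ F V] [ContMDiffVectorBundle ∞ F V 𝓘(ℝ, E)]

variable (E) in
/-- Smooth sections of a vector bundle `V` with model fiber `F` over `M`. -/
def IsSmoothSection (s : Π x : M, V x) : Prop :=
  ContMDiff 𝓘(ℝ, E) (𝓘(ℝ, E).prod 𝓘(ℝ, F)) ∞ (fun x => TotalSpace.mk' F x (s x))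

/-- `bracket`, restricted to smooth sections, and the bundle map `anchor : V → TM` form a Leibniz
algebroid structure on the smooth vector bundle `V`. -/
structure IsLeibnizAlgebroid
    (bracket : (Π x : M, V x) → (Π x : M, V x) → Π x : M, V x)
    (anchor : Π x : M, V x →L[ℝ] TangentSpace 𝓘(ℝ, E) x) : Prop where
  smooth_anchor : ContMDiff (𝓘(ℝ, E).prod 𝓘(ℝ, F)) 𝓘(ℝ, E).tangent ∞
    (fun p : TotalSpace F V => (⟨p.1, anchor p.1 p.2⟩ : TangentBundle 𝓘(ℝ, E) M))
  smooth_bracket : ∀ s t, IsSmoothSection E F s → IsSmoothSection E F t →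
    IsSmoothSection E F (bracket s t)
  add_bracket : ∀ s s' t, IsSmoothSection E F s → IsSmoothSection E F s' →
    IsSmoothSection E F t → bracket (s + s') t = bracket s t + bracket s' t
  bracket_add : ∀ s t t', IsSmoothSection E F s → IsSmoothSection E F t →
    IsSmoothSection E F t' → bracket s (t + t') = bracket s t + bracket s t'
  smul_bracket : ∀ (c : ℝ) s t, IsSmoothSection E F s → IsSmoothSection E F t →
    bracket (c • s) t = c • bracket s t
  bracket_smul : ∀ (c : ℝ) s t, IsSmoothSection E F s → IsSmoothSection E F t →
    bracket s (c • t) = c • bracket s t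
  leibniz : ∀ r s t, IsSmoothSection E F r → IsSmoothSection E F s → IsSmoothSection E F t →
    bracket r (bracket s t) = bracket (bracket r s) t + bracket s (bracket r t)
  anchor_bracket : ∀ s t, IsSmoothSection E F s → IsSmoothSection E F t →
    (fun x => anchor x (bracket s t x)) =
      mlieBracket 𝓘(ℝ, E) (fun x => anchor x (s x)) (fun x => anchor x (t x))
  bracket_fun_smul : ∀ s t (f : M → ℝ), IsSmoothSection E F s → IsSmoothSection E F t →
    ContMDiff 𝓘(ℝ, E) 𝓘(ℝ, ℝ) ∞ f →
    bracket s (fun x => f x • t x) =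
      fun x => f x • bracket s t x + derivAlong (fun y => anchor y (s y)) f x • t x

end Algebroid

/-! ### The higher-order Dorfman bracket -/

section Dorfman

universe u v
variable {E : Type u} [NormedAddCommGroup E] [NormedSpace ℝ E]
  {M : Type v} [TopologicalSpace M] [ChartedSpace E M]

variable (E) in
/-- The model fiber of `𝒯ⁿ = TM ⊕ ∧ⁿ T*M`. -/
abbrev Model (n : ℕ) : Type u := E × (E [⋀^Fin n]→L[ℝ] ℝ)

variable (E) in
/-- The bundle `𝒯ⁿ = TM ⊕ ∧ⁿ T*M`. -/
abbrev HigherTangent (n : ℕ) : M → Type u := (TangentSpace 𝓘(ℝ, E) : M → Type u) ×ᵇ ExtCotangent E n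

variable {n : ℕ}

/-- The projection `ρ : 𝒯ⁿ → TM`. -/
def rho (x : M) : HigherTangent E n x →L[ℝ] TangentSpace 𝓘(ℝ, E) x :=
  ContinuousLinearMap.fst ℝ (TangentSpace 𝓘(ℝ, E) x) (ExtCotangent E n x)

/-- The vector field part `X = ρ(e)` of a section `e = X + α` of `𝒯ⁿ`. -/
def vec (e : Π x : M, HigherTangent E n x) : Π x : M, TangentSpace 𝓘(ℝ, E) x := fun x => rho x (e x)

/-- The form part `α` of a section `e = X + α` of `𝒯ⁿ`. -/
def form (e : Π x : M, HigherTangent E n x) : Π x : M, ExtCotangent E n x := fun x => (e x).2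

/-- The pairing `⟨X + α, Y + β⟩ = ½ (i_X β + i_Y α)` with values in `(n-1)`-forms. -/
def pairing (e₁ e₂ : Π x : M, HigherTangent E n x) : Π x : M, ExtCotangentPred E n x :=
  (1 / 2 : ℝ) • (interior (vec e₁) (form e₂) + interior (vec e₂) (form e₁))

/-- The higher-order Dorfman bracket
`[X + α, Y + β] = [X, Y] + L_X β - L_Y α + d i_Y α`. -/
def dorfman (e₁ e₂ : Π x : M, HigherTangent E n x) : Π x : M, HigherTangent E n x := fun x =>
  (mlieBracket 𝓘(ℝ, E) (vec e₁) (vec e₂) x,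
    lieDer (vec e₁) (form e₂) x - lieDer (vec e₂) (form e₁) x
      + extDerPred (interior (vec e₂) (form e₁)) x)

/-- An `n`-form, viewed as the section `0 + α` of `𝒯ⁿ`. -/
def ofForm (α : Π x : M, ExtCotangent E n x) : Π x : M, HigherTangent E n x := fun x => (0, α x)

end Dorfman

end HigherDorfman

end

open HigherDorfman

/-! Everything is formal once the Cartan calculus is available. Write `e₁ = X + α`, `e₂ = Y + β`,
`e₃ = Z + γ`. Cartan's formula `L_Y = d i_Y + i_Y d` collapses the form part of the bracket to `L_X
β - i_Y dα` (`form_dorfman`). The rest uses `d² = 0`, `[L_X, d] = 0`, `[L_X, i_Y] = i_[X,Y]`, `[L_X,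
L_Y] = L_[X,Y]` and `i_X i_Y = -i_Y i_X`.

Leibniz identity (`dorfman_leibniz`): vector parts satisfy the Jacobi identity; in the form part the
terms in `γ`, `β` and `α` match separately. Invariance (`pairing_invariant`): apply `[L_X, i_Y] =
i_[X,Y]` to both halves of the pairing; the two double contractions of `dα` cancel.
Function-linearity in the second slot fails only by `X(f)`, since `i_Y dα` is tensorial in `Y`. In
the first slot, `L_{fX} β` contributes `df ∧ i_X β` and `d(f i_Y α)` contributes `df ∧ i_Y α`, which
add up to `df ∧ 2⟨e₁, e₂⟩`.

The calculus is first proved on `E` and then transported pointwise through the chart at each point.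
Chart independence is needed only for `d` (`chartForm_extDer`) and for contractions
(`chartForm_iota`). Smoothness of `L_X η` and the relation for `[L_X, L_Y]` then follow from
Cartan's formula, without comparing Lie derivatives in two charts. -/

noncomputable section

namespace HigherDorfman

/-! ### Cartan calculus on a normed space -/

section VectorSpace

variable {E : Type*} [NormedAddCommGroup E] [NormedSpace ℝ E] {n : ℕ}

/-- The interior product of a form with a vector field on a normed space. -/
def iotaVec (X : E → E) (η : E → E [⋀^Fin (n + 1)]→L[ℝ] ℝ) (y : E) : E [⋀^Fin n]→L[ℝ] ℝ :=
  (η y).curryLeft (X y)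

/-- `ContinuousAlternatingMap.curryLeft` as a continuous linear map. -/
def curryLeftCLM (E : Type*) [NormedAddCommGroup E] [NormedSpace ℝ E] (n : ℕ) :
    (E [⋀^Fin (n + 1)]→L[ℝ] ℝ) →L[ℝ] E →L[ℝ] E [⋀^Fin n]→L[ℝ] ℝ :=
  (ContinuousAlternatingMap.curryLeftLI (𝕜 := ℝ) (E := E) (F := ℝ) (n := n)).toContinuousLinearMap

theorem hasFDerivAt_curryLeftCLM (θ : E [⋀^Fin (n + 1)]→L[ℝ] ℝ) :
    HasFDerivAt (fun η => curryLeftCLM E n η) (curryLeftCLM E n) θ :=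
  ContinuousLinearMap.hasFDerivAt _

theorem contDiff_curryLeftCLM : ContDiff ℝ ∞ (fun η => curryLeftCLM E n η) :=
  ContinuousLinearMap.contDiff (𝕜 := ℝ) (E := E [⋀^Fin (n + 1)]→L[ℝ] ℝ)
    (F := E →L[ℝ] E [⋀^Fin n]→L[ℝ] ℝ) (curryLeftCLM E n)

/-- The product rule for the bilinear evaluation of `curryLeft (η z)` at `X z`. -/
theorem hasFDerivAt_iotaVec {X : E → E} {η : E → E [⋀^Fin (n + 1)]→L[ℝ] ℝ} {y : E}
    (hX : DifferentiableAt ℝ X y) (hη : DifferentiableAt ℝ η y) :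
    HasFDerivAt (iotaVec X η)
      (((curryLeftCLM E n (η y)).comp (fderiv ℝ X y)) +
        ((curryLeftCLM E n).comp (fderiv ℝ η y)).flip (X y)) y :=
  HasFDerivAt.clm_apply (c := fun z => curryLeftCLM E n (η z))
    ((hasFDerivAt_curryLeftCLM (η y)).comp y hη.hasFDerivAt) hX.hasFDerivAt

theorem fderiv_iotaVec_apply {X : E → E} {η : E → E [⋀^Fin (n + 1)]→L[ℝ] ℝ} {y : E}
    (hX : DifferentiableAt ℝ X y) (hη : DifferentiableAt ℝ η y) (u : E) (v : Fin n → E) :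
    fderiv ℝ (iotaVec X η) y u v =
      η y (Matrix.vecCons (fderiv ℝ X y u) v) + fderiv ℝ η y u (Matrix.vecCons (X y) v) := by
  rw [(hasFDerivAt_iotaVec hX hη).fderiv]
  rfl

theorem ContDiffAt.iotaVec {X : E → E} {η : E → E [⋀^Fin (n + 1)]→L[ℝ] ℝ} {y : E}
    (hX : ContDiffAt ℝ ∞ X y) (hη : ContDiffAt ℝ ∞ η y) :
    ContDiffAt ℝ ∞ (HigherDorfman.iotaVec X η) y :=
  ContDiffAt.clm_apply (f := fun z => curryLeftCLM E n (η z))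
    (contDiff_curryLeftCLM.contDiffAt.comp y hη) hX

theorem extDeriv_apply_eq_sum (η : E → E [⋀^Fin n]→L[ℝ] ℝ) (y : E) (v : Fin (n + 1) → E) :
    extDeriv η y v = ∑ i : Fin (n + 1), (-1 : ℤ) ^ (i : ℕ) • fderiv ℝ η y (v i) (i.removeNth v) := by
  rw [extDeriv, ContinuousAlternatingMap.alternatizeUncurryFin_apply]

/-- Moving slot `i` to the front takes `i` transpositions. This gives the sum in the Lie derivative
the signs of the sum defining `extDeriv`. -/
theorem apply_update_eq (θ : E [⋀^Fin (n + 1)]→L[ℝ] ℝ)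
    (v : Fin (n + 1) → E) (i : Fin (n + 1)) (u : E) :
    θ (Function.update v i u) = (-1 : ℤ) ^ (i : ℕ) • θ (Matrix.vecCons u (i.removeNth v)) := by
  rw [← Fin.insertNth_removeNth, ContinuousAlternatingMap.map_insertNth]

/-- Cartan's formula on functions. -/
theorem lieDerVec_zero (X : E → E) (η : E → E [⋀^Fin 0]→L[ℝ] ℝ) (y : E) :
    lieDerVec X η y = (extDeriv η y).curryLeft (X y) := by
  ext v
  rw [lieDerVec_apply, ContinuousAlternatingMap.curryLeft_apply_apply, extDeriv_apply_eq_sum]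
  simp only [Finset.univ_eq_empty, Finset.sum_empty, add_zero, Fin.sum_univ_succ]
  simp

/-- Cartan's formula `L_X = d i_X + i_X d` on forms of positive degree. -/
theorem lieDerVec_succ {X : E → E} {η : E → E [⋀^Fin (n + 1)]→L[ℝ] ℝ} {y : E}
    (hX : DifferentiableAt ℝ X y) (hη : DifferentiableAt ℝ η y) :
    lieDerVec X η y = extDeriv (iotaVec X η) y + (extDeriv η y).curryLeft (X y) := by
  ext v
  rw [lieDerVec_apply, ContinuousAlternatingMap.add_apply,
    ContinuousAlternatingMap.curryLeft_apply_apply, extDeriv_apply_eq_sum, extDeriv_apply_eq_sum,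
    Fin.sum_univ_succ (fun i => _ • fderiv ℝ η y (Matrix.vecCons (X y) v i) _)]
  simp only [fderiv_iotaVec_apply hX hη, smul_add, Finset.sum_add_distrib,
    apply_update_eq]
  -- Deleting slot `i + 1` of `(X, v)` keeps `X` in front, so these terms of `i_X dη` carry the sign
  -- opposite to the `Dη` terms of `d i_X η` and cancel them.
  have h (i : Fin (n + 1)) : (i.succ.removeNth (Matrix.vecCons (X y) v) : Fin (n + 1) → E) =
      Matrix.vecCons (X y) (i.removeNth v) := by
    ext j
    refine Fin.cases ?_ (fun k => ?_) j <;> simp [Fin.removeNth]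
  simp only [h]
  simp [pow_succ, Fin.removeNth_zero, Finset.sum_neg_distrib]
  ring

/-- The formula `[L_X, i_Y] = i_[X, Y]`. -/
theorem lieDerVec_iotaVec {X Y : E → E} {η : E → E [⋀^Fin (n + 1)]→L[ℝ] ℝ} {y : E}
    (hY : DifferentiableAt ℝ Y y) (hη : DifferentiableAt ℝ η y) :
    lieDerVec X (iotaVec Y η) y =
      (lieDerVec X η y).curryLeft (Y y) + (η y).curryLeft (lieBracket ℝ X Y y) := by
  ext v
  simp only [ContinuousAlternatingMap.add_apply, ContinuousAlternatingMap.curryLeft_apply_apply,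
    lieDerVec_apply, fderiv_iotaVec_apply hY hη, Fin.sum_univ_succ, iotaVec, lieBracket]
  -- Slot `0` of `L_X η` on `(Y, v)` gives `η(DX(Y), v)`; together with the bracket term `η(DY(X) -
  -- DX(Y), v)` it leaves the `η(DY(X), v)` produced by differentiating `i_Y η`.
  have h0 (u w : E) : Function.update (Matrix.vecCons u v) 0 w = Matrix.vecCons w v := by
    ext j; refine Fin.cases ?_ (fun k => ?_) j <;> simp
  have h (i : Fin n) (w : E) : Function.update (Matrix.vecCons (Y y) v) i.succ w =
      Matrix.vecCons (Y y) (Function.update v i w) := by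
    ext j
    refine Fin.cases ?_ (fun k => ?_) j
    · rw [Function.update_of_ne (Fin.succ_ne_zero i).symm]; rfl
    · simp [Function.update_apply]
  simp only [Matrix.cons_val_zero, Matrix.cons_val_succ, h0, h]
  have hs (a b : E) : η y (Matrix.vecCons (a - b) v) =
      η y (Matrix.vecCons a v) - η y (Matrix.vecCons b v) := by
    exact congrArg (fun θ : E [⋀^Fin n]→L[ℝ] ℝ => θ v) (map_sub (η y).curryLeft a b)
  rw [hs]
  ring

/-- Polarisation: contracting twice with `u + w` gives zero, and so do the two diagonal terms. -/
theorem curryLeft_curryLeft_swap (θ : E [⋀^Fin (n + 2)]→L[ℝ] ℝ) (u w : E) :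
    (θ.curryLeft u).curryLeft w = -(θ.curryLeft w).curryLeft u := by
  have h := ContinuousAlternatingMap.curryLeft_same θ (u + w)
  have h1 := ContinuousAlternatingMap.curryLeft_same θ u
  have h2 := ContinuousAlternatingMap.curryLeft_same θ w
  simp only [map_add, ContinuousAlternatingMap.curryLeft_add, add_apply, h1, h2] at h
  simp only [zero_add, add_zero] at h
  exact eq_neg_of_add_eq_zero_right h

theorem fderiv_fun_smul_form {f : E → ℝ} {η : E → E [⋀^Fin n]→L[ℝ] ℝ} {y : E}
    (hf : DifferentiableAt ℝ f y) (hη : DifferentiableAt ℝ η y) :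
    fderiv ℝ (fun z => f z • η z) y = f y • fderiv ℝ η y + (fderiv ℝ f y).smulRight (η y) :=
  fderiv_fun_smul hf hη

/-- The Leibniz rule `d(f η) = f dη + df ∧ η`. -/
theorem extDeriv_fun_smul_form {f : E → ℝ} {η : E → E [⋀^Fin n]→L[ℝ] ℝ} {y : E}
    (hf : DifferentiableAt ℝ f y) (hη : DifferentiableAt ℝ η y) :
    extDeriv (fun z => f z • η z) y = f y • extDeriv η y +
      ContinuousAlternatingMap.alternatizeUncurryFin ((fderiv ℝ f y).smulRight (η y)) := by
  rw [extDeriv, fderiv_fun_smul_form hf hη, ContinuousAlternatingMap.alternatizeUncurryFin_add,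
    ContinuousAlternatingMap.alternatizeUncurryFin_smul, extDeriv]

/-- The Leibniz rule `L_X (f η) = f L_X η + X(f) η`. -/
theorem lieDerVec_fun_smul_form {X : E → E} {f : E → ℝ} {η : E → E [⋀^Fin n]→L[ℝ] ℝ} {y : E}
    (hf : DifferentiableAt ℝ f y) (hη : DifferentiableAt ℝ η y) :
    lieDerVec X (fun z => f z • η z) y =
      f y • lieDerVec X η y + fderiv ℝ f y (X y) • η y := by
  ext v
  simp only [ContinuousAlternatingMap.add_apply, ContinuousAlternatingMap.smul_apply,
    lieDerVec_apply, fderiv_fun_smul_form hf hη, add_apply, smul_apply,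
    ContinuousLinearMap.smulRight_apply, smul_eq_mul, mul_add, Finset.mul_sum]
  ring

theorem lieDerVec_add_form {X : E → E} {η ζ : E → E [⋀^Fin n]→L[ℝ] ℝ} {y : E}
    (hη : DifferentiableAt ℝ η y) (hζ : DifferentiableAt ℝ ζ y) :
    lieDerVec X (fun z => η z + ζ z) y = lieDerVec X η y + lieDerVec X ζ y := by
  ext v
  simp only [ContinuousAlternatingMap.add_apply, lieDerVec_apply, fderiv_fun_add hη hζ,
    add_apply, Finset.sum_add_distrib]
  ring

theorem lieDerVec_add_field {X Y : E → E} {η : E → E [⋀^Fin n]→L[ℝ] ℝ} {y : E}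
    (hX : DifferentiableAt ℝ X y) (hY : DifferentiableAt ℝ Y y) :
    lieDerVec (fun z => X z + Y z) η y = lieDerVec X η y + lieDerVec Y η y := by
  ext v
  simp only [ContinuousAlternatingMap.add_apply, lieDerVec_apply, fderiv_fun_add hX hY,
    add_apply, Finset.sum_add_distrib, map_add, ContinuousAlternatingMap.map_update_add]
  ring

/-- The rule `L_{f X} η = f L_X η` on functions. -/
theorem lieDerVec_fun_smul_field_zero (X : E → E) (f : E → ℝ) (η : E → E [⋀^Fin 0]→L[ℝ] ℝ)
    (y : E) : lieDerVec (fun z => f z • X z) η y = f y • lieDerVec X η y := by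
  rw [lieDerVec_zero, lieDerVec_zero, map_smul]

/-- The rule `L_{f X} η = f L_X η + df ∧ i_X η` on forms of positive degree. -/
theorem lieDerVec_fun_smul_field_succ {X : E → E} {f : E → ℝ}
    {η : E → E [⋀^Fin (n + 1)]→L[ℝ] ℝ} {y : E}
    (hf : DifferentiableAt ℝ f y) (hX : DifferentiableAt ℝ X y) (hη : DifferentiableAt ℝ η y) :
    lieDerVec (fun z => f z • X z) η y = f y • lieDerVec X η y +
      ContinuousAlternatingMap.alternatizeUncurryFin
        ((fderiv ℝ f y).smulRight ((η y).curryLeft (X y))) := by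
  -- As `i_{fX} = f i_X`, Cartan's formula leaves the Leibniz rule for `d(f i_X η)` as the only
  -- source of `df`.
  have h : iotaVec (fun z => f z • X z) η = fun z => f z • iotaVec X η z :=
    funext fun z => map_smul (η z).curryLeft _ _
  rw [lieDerVec_succ (hf.fun_smul hX) hη, lieDerVec_succ hX hη, h,
    extDeriv_fun_smul_form hf (hasFDerivAt_iotaVec hX hη).differentiableAt, map_smul, smul_add]
  simp only [iotaVec]
  abel

theorem contDiffAt_extDeriv {η : E → E [⋀^Fin n]→L[ℝ] ℝ} {y : E} (hη : ContDiffAt ℝ ∞ η y) :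
    ContDiffAt ℝ ∞ (extDeriv η) y :=
  (ContinuousAlternatingMap.alternatizeUncurryFinCLM ℝ E ℝ).contDiff.contDiffAt.comp y
    (hη.fderiv_right (by exact_mod_cast le_top))

end VectorSpace

/-- The C² threshold behind `d² = 0`, naturality of `d` under pullback and the Jacobi identity. -/
theorem two_le_infty : minSmoothness ℝ 2 ≤ ∞ := by
  rw [minSmoothness_of_isRCLikeNormedField]
  exact WithTop.coe_le_coe.2 (le_top : (2 : ℕ∞) ≤ ⊤)

/-! ### Chart expressions of vector fields and forms -/

section Charts

variable {E : Type*} [NormedAddCommGroup E] [NormedSpace ℝ E]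
  {M : Type*} [TopologicalSpace M] [ChartedSpace E M] {n : ℕ}

/-- A form all of whose chart expressions are smooth. -/
def SmoothForm (η : Π x : M, ExtCotangent E n x) : Prop :=
  ∀ x₀ : M, ContDiffOn ℝ ∞ (chartForm η x₀) (extChartAt 𝓘(ℝ, E) x₀).target

/-- A vector field all of whose chart expressions are smooth. -/
def SmoothField (X : Π x : M, TangentSpace 𝓘(ℝ, E) x) : Prop :=
  ∀ x₀ : M, ContDiffOn ℝ ∞ (chartField X x₀) (extChartAt 𝓘(ℝ, E) x₀).target

theorem SmoothForm.contDiffAt {η : Π x : M, ExtCotangent E n x} (hη : SmoothForm η) {x₀ : M}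
    {y : E} (hy : y ∈ (extChartAt 𝓘(ℝ, E) x₀).target) : ContDiffAt ℝ ∞ (chartForm η x₀) y :=
  (hη x₀).contDiffAt ((isOpen_extChartAt_target x₀).mem_nhds hy)

theorem SmoothField.contDiffAt {X : Π x : M, TangentSpace 𝓘(ℝ, E) x} (hX : SmoothField X) {x₀ : M}
    {y : E} (hy : y ∈ (extChartAt 𝓘(ℝ, E) x₀).target) : ContDiffAt ℝ ∞ (chartField X x₀) y :=
  (hX x₀).contDiffAt ((isOpen_extChartAt_target x₀).mem_nhds hy)

theorem SmoothForm.differentiableAt {η : Π x : M, ExtCotangent E n x} (hη : SmoothForm η) (x : M) :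
    DifferentiableAt ℝ (chartForm η x) (extChartAt 𝓘(ℝ, E) x x) :=
  (hη.contDiffAt (mem_extChartAt_target x)).differentiableAt (by simp)

theorem SmoothField.differentiableAt {X : Π x : M, TangentSpace 𝓘(ℝ, E) x} (hX : SmoothField X)
    (x : M) : DifferentiableAt ℝ (chartField X x) (extChartAt 𝓘(ℝ, E) x x) :=
  (hX.contDiffAt (mem_extChartAt_target x)).differentiableAt (by simp)

variable [IsManifold 𝓘(ℝ, E) ∞ M]

theorem isManifold_one : IsManifold 𝓘(ℝ, E) 1 M :=
  IsManifold.of_le (n := ∞) (by exact_mod_cast le_top)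

attribute [local instance] isManifold_one

/-! ### Derivatives of charts as tangent coordinate changes -/

/-- The tangent space at `w` is identified with `E` through the preferred chart at `w`, so the
derivative of an inverse chart is that of a transition map into this chart. -/
theorem mfderiv_extChartAt_symm_eq {x₀ : M} {y : E} (hy : y ∈ (extChartAt 𝓘(ℝ, E) x₀).target) :
    (mfderiv 𝓘(ℝ, E) 𝓘(ℝ, E) (extChartAt 𝓘(ℝ, E) x₀).symm y : E →L[ℝ] E) =
      tangentCoordChange 𝓘(ℝ, E) x₀ ((extChartAt 𝓘(ℝ, E) x₀).symm y)
        ((extChartAt 𝓘(ℝ, E) x₀).symm y) := by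
  set w := (extChartAt 𝓘(ℝ, E) x₀).symm y with hw
  have hws : w ∈ (extChartAt 𝓘(ℝ, E) x₀).source := (extChartAt 𝓘(ℝ, E) x₀).map_target hy
  have hyw : extChartAt 𝓘(ℝ, E) x₀ w = y := (extChartAt 𝓘(ℝ, E) x₀).right_inv hy
  have h := hasFDerivWithinAt_tangentCoordChange (I := 𝓘(ℝ, E)) (x := x₀) (y := w) (z := w)
    ⟨hws, mem_extChartAt_source w⟩
  rw [hyw] at h
  refine HasMFDerivAt.mfderiv ⟨continuousAt_extChartAt_symm'' hy, ?_⟩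
  exact h

theorem mfderiv_extChartAt_eq {x₀ x : M} (hx : x ∈ (extChartAt 𝓘(ℝ, E) x₀).source) :
    (mfderiv 𝓘(ℝ, E) 𝓘(ℝ, E) (extChartAt 𝓘(ℝ, E) x₀) x : E →L[ℝ] E) =
      tangentCoordChange 𝓘(ℝ, E) x x₀ x :=
  mfderiv_chartAt_eq_tangentCoordChange (I := 𝓘(ℝ, E)) (by rwa [extChartAt_source] at hx)

theorem tangentCoordChange_self_eq_id (x : M) :
    tangentCoordChange 𝓘(ℝ, E) x x x = ContinuousLinearMap.id ℝ E :=
  ContinuousLinearMap.ext fun _ => tangentCoordChange_self (mem_extChartAt_source x)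

/-- In the preferred chart at `x` the chart derivative at `x` is the identity. Hence `extDer` and
`lieDer` at `x` are literally the normed-space expressions there. -/
theorem ofChart_eq (x : M) (η : E [⋀^Fin n]→L[ℝ] ℝ) : ofChart x η = η :=
  congrArg (fun A : E →L[ℝ] E => η.compContinuousLinearMap A)
    ((mfderiv_extChartAt_eq (mem_extChartAt_source x)).trans (tangentCoordChange_self_eq_id x))

theorem chartForm_eq (η : Π x : M, ExtCotangent E n x) {x₀ : M} {y : E}
    (hy : y ∈ (extChartAt 𝓘(ℝ, E) x₀).target) :
    chartForm η x₀ y = ContinuousAlternatingMap.compContinuousLinearMap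
      (show E [⋀^Fin n]→L[ℝ] ℝ from η ((extChartAt 𝓘(ℝ, E) x₀).symm y))
      (tangentCoordChange 𝓘(ℝ, E) x₀ ((extChartAt 𝓘(ℝ, E) x₀).symm y)
        ((extChartAt 𝓘(ℝ, E) x₀).symm y)) :=
  congrArg (ContinuousAlternatingMap.compContinuousLinearMap _) (mfderiv_extChartAt_symm_eq hy)

/-- By the cocycle condition; needed because `mpullback` is defined with the inverse of the
derivative. -/
theorem tangentCoordChange_inverse {x₀ w : M} (hw : w ∈ (extChartAt 𝓘(ℝ, E) x₀).source) :
    ContinuousLinearMap.inverse (tangentCoordChange 𝓘(ℝ, E) x₀ w w) =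
      tangentCoordChange 𝓘(ℝ, E) w x₀ w := by
  refine ContinuousLinearMap.inverse_eq (ContinuousLinearMap.ext fun v => ?_)
    (ContinuousLinearMap.ext fun v => ?_)
  · exact (tangentCoordChange_comp ⟨⟨mem_extChartAt_source w, hw⟩, mem_extChartAt_source w⟩).trans
      (tangentCoordChange_self (mem_extChartAt_source w))
  · exact (tangentCoordChange_comp ⟨⟨hw, mem_extChartAt_source w⟩, hw⟩).trans
      (tangentCoordChange_self hw)

theorem chartField_eq (X : Π x : M, TangentSpace 𝓘(ℝ, E) x) {x₀ : M} {y : E}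
    (hy : y ∈ (extChartAt 𝓘(ℝ, E) x₀).target) :
    chartField X x₀ y = tangentCoordChange 𝓘(ℝ, E) ((extChartAt 𝓘(ℝ, E) x₀).symm y) x₀
        ((extChartAt 𝓘(ℝ, E) x₀).symm y) (X ((extChartAt 𝓘(ℝ, E) x₀).symm y)) := by
  have h : chartField X x₀ y = ContinuousLinearMap.inverse
      (mfderiv 𝓘(ℝ, E) 𝓘(ℝ, E) (extChartAt 𝓘(ℝ, E) x₀).symm y : E →L[ℝ] E)
      (X ((extChartAt 𝓘(ℝ, E) x₀).symm y)) := rfl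
  rw [h]
  exact congrArg (fun A : E →L[ℝ] E => A (X ((extChartAt 𝓘(ℝ, E) x₀).symm y)))
    ((congrArg (fun A : E →L[ℝ] E => A.inverse) (mfderiv_extChartAt_symm_eq hy)).trans
      (tangentCoordChange_inverse ((extChartAt 𝓘(ℝ, E) x₀).map_target hy)))

theorem chartForm_self (η : Π x : M, ExtCotangent E n x) (x : M) :
    chartForm η x (extChartAt 𝓘(ℝ, E) x x) = η x := by
  have h := chartForm_eq η (mem_extChartAt_target (I := 𝓘(ℝ, E)) x)
  rw [extChartAt_to_inv] at h
  rw [h, tangentCoordChange_self_eq_id]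
  rfl

theorem chartField_self (X : Π x : M, TangentSpace 𝓘(ℝ, E) x) (x : M) :
    chartField X x (extChartAt 𝓘(ℝ, E) x x) = X x := by
  have h := chartField_eq X (mem_extChartAt_target (I := 𝓘(ℝ, E)) x)
  rw [extChartAt_to_inv] at h
  rw [h]
  exact tangentCoordChange_self (mem_extChartAt_source x)

/-- A section of a vector bundle is smooth if and only if its expressions in all preferred
trivializations and charts are smooth. -/
theorem isSmoothSection_iff_contDiffOn {F : Type*} [NormedAddCommGroup F] [NormedSpace ℝ F]
    {V : M → Type*} [TopologicalSpace (TotalSpace F V)]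
    [∀ x, AddCommGroup (V x)] [∀ x, Module ℝ (V x)] [∀ x, TopologicalSpace (V x)]
    [FiberBundle F V] [VectorBundle ℝ F V] [ContMDiffVectorBundle ∞ F V 𝓘(ℝ, E)]
    (hV : ∀ x₀ : M, (trivializationAt F V x₀).baseSet = (chartAt E x₀).source)
    (s : Π x, V x) :
    IsSmoothSection E F s ↔ ∀ x₀ : M, ContDiffOn ℝ ∞ (fun y =>
      (trivializationAt F V x₀ ⟨(extChartAt 𝓘(ℝ, E) x₀).symm y,
        s ((extChartAt 𝓘(ℝ, E) x₀).symm y)⟩).2) (extChartAt 𝓘(ℝ, E) x₀).target := by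
  constructor
  · intro h x₀
    have h1 : ContMDiffOn 𝓘(ℝ, E) 𝓘(ℝ, F) ∞
        (fun x => (trivializationAt F V x₀ ⟨x, s x⟩).2) (extChartAt 𝓘(ℝ, E) x₀).source := by
      intro x hx
      refine (((trivializationAt F V x₀).contMDiffAt_section_iff ?_).1 (h x)).contMDiffWithinAt
      rwa [hV, ← extChartAt_source 𝓘(ℝ, E)]
    exact (h1.comp (contMDiffOn_extChartAt_symm x₀)
      (fun y hy => (extChartAt 𝓘(ℝ, E) x₀).map_target hy)).contDiffOn
  · intro h x₀
    rw [contMDiffAt_section]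
    have h1 := ((h x₀).contDiffAt ((isOpen_extChartAt_target x₀).mem_nhds
      (mem_extChartAt_target (I := 𝓘(ℝ, E)) x₀))).contMDiffAt.comp x₀
      (contMDiffAt_extChartAt (I := 𝓘(ℝ, E)) (n := ∞) (x := x₀))
    refine h1.congr_of_eventuallyEq ?_
    filter_upwards [extChartAt_source_mem_nhds (I := 𝓘(ℝ, E)) x₀] with x hx
    simp only [Function.comp_apply]
    rw [(extChartAt 𝓘(ℝ, E) x₀).left_inv hx]

/-- The bundle trivialization at `x₀` pulls a form back along the tangent coordinate change, which
is exactly the chart expression. -/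
theorem isSmoothSection_iff_smoothForm (η : Π x : M, ExtCotangent E n x) :
    IsSmoothSection E (E [⋀^Fin n]→L[ℝ] ℝ) η ↔ SmoothForm η := by
  rw [isSmoothSection_iff_contDiffOn (fun x₀ => rfl)]
  refine forall_congr' fun x₀ => contDiffOn_congr fun y hy => ?_
  rw [chartForm_eq η hy]
  rfl

theorem isSmoothSection_iff_smoothField (X : Π x : M, TangentSpace 𝓘(ℝ, E) x) :
    IsSmoothSection E E X ↔ SmoothField X := by
  rw [isSmoothSection_iff_contDiffOn (fun x₀ => rfl)]
  refine forall_congr' fun x₀ => contDiffOn_congr fun y hy => ?_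
  rw [chartField_eq X hy]
  rfl

/-- The exterior derivative is independent of the chart. -/
theorem chartForm_extDer {η : Π x : M, ExtCotangent E n x} (hη : SmoothForm η) {x₀ : M} {y : E}
    (hy : y ∈ (extChartAt 𝓘(ℝ, E) x₀).target) :
    chartForm (extDer η) x₀ y = extDeriv (chartForm η x₀) y := by
  -- The value of `extDer η` at `x` is computed in the chart at `x`, so the chart at `x₀` has to be
  -- compared with it; `T` is the transition map between the two.
  set x := (extChartAt 𝓘(ℝ, E) x₀).symm y with hx
  set T : E → E := extChartAt 𝓘(ℝ, E) x ∘ (extChartAt 𝓘(ℝ, E) x₀).symm with hT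
  have hD : ∀ z ∈ (extChartAt 𝓘(ℝ, E) x₀).target,
      (extChartAt 𝓘(ℝ, E) x₀).symm z ∈ (extChartAt 𝓘(ℝ, E) x).source →
      fderiv ℝ T z = tangentCoordChange 𝓘(ℝ, E) x₀ x ((extChartAt 𝓘(ℝ, E) x₀).symm z) := by
    intro z hz hzx
    have h := hasFDerivWithinAt_tangentCoordChange (I := 𝓘(ℝ, E)) (x := x₀) (y := x)
      (z := (extChartAt 𝓘(ℝ, E) x₀).symm z) ⟨(extChartAt 𝓘(ℝ, E) x₀).map_target hz, hzx⟩
    rw [(extChartAt 𝓘(ℝ, E) x₀).right_inv hz] at h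
    simp only [modelWithCornersSelf_coe, Set.range_id, hasFDerivWithinAt_univ] at h
    exact h.fderiv
  have hT' : ContDiffAt ℝ ∞ T y := by
    have h1 := ((contMDiffOn_extChartAt_symm (I := 𝓘(ℝ, E)) (n := ∞) x₀).contMDiffAt
      ((isOpen_extChartAt_target x₀).mem_nhds hy))
    exact (ContMDiffAt.comp y
      (contMDiffAt_extChartAt (I := 𝓘(ℝ, E)) (n := ∞) (x := x)) h1).contDiffAt
  have hnear : ∀ᶠ z in nhds y, z ∈ (extChartAt 𝓘(ℝ, E) x₀).target ∧
      (extChartAt 𝓘(ℝ, E) x₀).symm z ∈ (extChartAt 𝓘(ℝ, E) x).source := by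
    refine ((isOpen_extChartAt_target x₀).eventually_mem hy).and ?_
    exact (continuousAt_extChartAt_symm'' hy).preimage_mem_nhds (extChartAt_source_mem_nhds x)
  -- Near `y` the expression at `x₀` is the pullback along `T` of the one at `x`; the cocycle
  -- condition `hc` is the chain rule. Naturality of `extDeriv` then concludes.
  have heq : chartForm η x₀ =ᶠ[nhds y] fun z =>
      (chartForm η x (T z)).compContinuousLinearMap (fderiv ℝ T z) := by
    filter_upwards [hnear] with z hz
    have hTz : T z ∈ (extChartAt 𝓘(ℝ, E) x).target := (extChartAt 𝓘(ℝ, E) x).map_source hz.2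
    have hw : (extChartAt 𝓘(ℝ, E) x).symm (T z) = (extChartAt 𝓘(ℝ, E) x₀).symm z :=
      (extChartAt 𝓘(ℝ, E) x).left_inv hz.2
    rw [hD z hz.1 hz.2, chartForm_eq η hz.1, chartForm_eq η hTz, hw]
    have hc : tangentCoordChange 𝓘(ℝ, E) x₀ ((extChartAt 𝓘(ℝ, E) x₀).symm z)
          ((extChartAt 𝓘(ℝ, E) x₀).symm z) =
        (tangentCoordChange 𝓘(ℝ, E) x ((extChartAt 𝓘(ℝ, E) x₀).symm z)
          ((extChartAt 𝓘(ℝ, E) x₀).symm z)).comp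
        (tangentCoordChange 𝓘(ℝ, E) x₀ x ((extChartAt 𝓘(ℝ, E) x₀).symm z)) :=
      ContinuousLinearMap.ext fun v => (tangentCoordChange_comp
        ⟨⟨(extChartAt 𝓘(ℝ, E) x₀).map_target hz.1, hz.2⟩, mem_extChartAt_source _⟩).symm
    rw [hc]
    rfl
  rw [heq.extDeriv_eq, extDeriv_pullback (f := T) (r := ∞) (hη.differentiableAt x) hT'
    two_le_infty, chartForm_eq _ hy, hD y hy (mem_extChartAt_source x)]
  exact congrArg (fun θ : E [⋀^Fin (n + 1)]→L[ℝ] ℝ => θ.compContinuousLinearMap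
    (tangentCoordChange 𝓘(ℝ, E) x₀ x x)) (ofChart_eq x _)

end Charts

/-! ### Cartan calculus on a manifold -/

section Cartan

variable {E : Type*} [NormedAddCommGroup E] [NormedSpace ℝ E]
  {M : Type*} [TopologicalSpace M] [ChartedSpace E M] {n : ℕ}
  {X Y : Π x : M, TangentSpace 𝓘(ℝ, E) x} {η ζ : Π x : M, ExtCotangent E n x} {f : M → ℝ}

/-- The interior product on forms of positive degree. -/
def iota (X : Π x : M, TangentSpace 𝓘(ℝ, E) x) (η : Π x : M, ExtCotangent E (n + 1) x) :
    Π x : M, ExtCotangent E n x :=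
  interior X η

theorem chartForm_add (η ζ : Π x : M, ExtCotangent E n x) (x₀ : M) :
    chartForm (η + ζ) x₀ = fun y => chartForm η x₀ y + chartForm ζ x₀ y := rfl

theorem chartForm_smul (c : ℝ) (η : Π x : M, ExtCotangent E n x) (x₀ : M) :
    chartForm (c • η) x₀ = c • chartForm η x₀ := rfl

theorem chartField_add (X Y : Π x : M, TangentSpace 𝓘(ℝ, E) x) (x₀ : M) :
    chartField (X + Y) x₀ = fun y => chartField X x₀ y + chartField Y x₀ y :=
  mpullback_add

theorem chartField_fun_smul (f : M → ℝ) (X : Π x : M, TangentSpace 𝓘(ℝ, E) x) (x₀ : M) :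
    chartField (fun x => f x • X x) x₀ =
      fun y => (f ∘ (extChartAt 𝓘(ℝ, E) x₀).symm) y • chartField X x₀ y :=
  mpullback_smul (g := f)

theorem SmoothForm.add (hη : SmoothForm η) (hζ : SmoothForm ζ) : SmoothForm (η + ζ) :=
  fun x₀ => (hη x₀).add (hζ x₀)

theorem SmoothForm.sub (hη : SmoothForm η) (hζ : SmoothForm ζ) : SmoothForm (η - ζ) :=
  fun x₀ => (hη x₀).sub (hζ x₀)

theorem smoothForm_zero : SmoothForm (0 : Π x : M, ExtCotangent E n x) :=
  fun _ => (contDiffOn_const (c := (0 : E [⋀^Fin n]→L[ℝ] ℝ))).congr fun _ _ => rfl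

theorem iota_iota_swap (X Y : Π x : M, TangentSpace 𝓘(ℝ, E) x)
    (η : Π x : M, ExtCotangent E (n + 2) x) : iota X (iota Y η) = -iota Y (iota X η) :=
  funext fun x => curryLeft_curryLeft_swap (show E [⋀^Fin (n + 2)]→L[ℝ] ℝ from η x) (Y x) (X x)

theorem mfderiv_eq_fderiv_comp_symm (hf : ContMDiff 𝓘(ℝ, E) 𝓘(ℝ, ℝ) ∞ f) (x : M) :
    (mfderiv 𝓘(ℝ, E) 𝓘(ℝ, ℝ) f x : E →L[ℝ] ℝ) =
      fderiv ℝ (f ∘ (extChartAt 𝓘(ℝ, E) x).symm) (extChartAt 𝓘(ℝ, E) x x) := by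
  rw [((hf x).mdifferentiableAt (by simp)).mfderiv]
  simp only [modelWithCornersSelf_coe, Set.range_id, fderivWithin_univ]
  rfl

theorem comp_symm_self (f : M → ℝ) (x : M) :
    (f ∘ (extChartAt 𝓘(ℝ, E) x).symm) (extChartAt 𝓘(ℝ, E) x x) = f x :=
  congrArg f (extChartAt_to_inv x)

variable [IsManifold 𝓘(ℝ, E) ∞ M]

attribute [local instance] isManifold_one

theorem extDer_apply (η : Π x : M, ExtCotangent E n x) (x : M) :
    extDer η x = extDeriv (chartForm η x) (extChartAt 𝓘(ℝ, E) x x) :=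
  ofChart_eq x _

theorem lieDer_apply (X : Π x : M, TangentSpace 𝓘(ℝ, E) x) (η : Π x : M, ExtCotangent E n x)
    (x : M) : lieDer X η x =
      lieDerVec (chartField X x) (chartForm η x) (extChartAt 𝓘(ℝ, E) x x) :=
  ofChart_eq x _

/-- Contraction is pointwise, and the coordinate changes applied to the form and to the vector are
inverse to each other. Validity on the whole chart, not just at its base point, allows
differentiation. -/
theorem chartForm_iota (X : Π x : M, TangentSpace 𝓘(ℝ, E) x)
    (η : Π x : M, ExtCotangent E (n + 1) x) {x₀ : M} {y : E}
    (hy : y ∈ (extChartAt 𝓘(ℝ, E) x₀).target) :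
    chartForm (iota X η) x₀ y = iotaVec (chartField X x₀) (chartForm η x₀) y := by
  have hw := (extChartAt 𝓘(ℝ, E) x₀).map_target hy
  rw [iotaVec, chartForm_eq _ hy, chartForm_eq _ hy, chartField_eq _ hy]
  set w := (extChartAt 𝓘(ℝ, E) x₀).symm y
  refine ContinuousAlternatingMap.ext fun v => ?_
  refine congrArg (fun u : Fin (n + 1) → E => (show E [⋀^Fin (n + 1)]→L[ℝ] ℝ from η w) u) ?_
  funext k
  refine Fin.cases ?_ (fun j => ?_) k
  · exact ((tangentCoordChange_comp ⟨⟨mem_extChartAt_source w, hw⟩, mem_extChartAt_source w⟩).trans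
      (tangentCoordChange_self (mem_extChartAt_source w))).symm
  · rfl

theorem chartForm_iota_eventuallyEq (X : Π x : M, TangentSpace 𝓘(ℝ, E) x)
    (η : Π x : M, ExtCotangent E (n + 1) x) (x : M) :
    chartForm (iota X η) x =ᶠ[nhds (extChartAt 𝓘(ℝ, E) x x)]
      iotaVec (chartField X x) (chartForm η x) :=
  Filter.eventually_of_mem (extChartAt_target_mem_nhds x) fun _ hy => chartForm_iota X η hy

theorem SmoothForm.iota {η : Π x : M, ExtCotangent E (n + 1) x} (hX : SmoothField X)
    (hη : SmoothForm η) : SmoothForm (iota X η) := fun _ => ContDiffOn.congr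
  (fun _ hy => ((hX.contDiffAt hy).iotaVec (hη.contDiffAt hy)).contDiffWithinAt)
  fun _ hy => chartForm_iota X η hy

theorem SmoothForm.extDer (hη : SmoothForm η) : SmoothForm (extDer η) := fun _ => ContDiffOn.congr
  (fun _ hy => (contDiffAt_extDeriv (hη.contDiffAt hy)).contDiffWithinAt)
  fun _ hy => chartForm_extDer hη hy

theorem extDer_extDer (hη : SmoothForm η) : extDer (extDer η) = 0 := by
  funext x
  rw [extDer_apply, Filter.EventuallyEq.extDeriv_eq (Filter.eventually_of_mem
    (extChartAt_target_mem_nhds x) fun y hy => chartForm_extDer hη hy)]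
  exact extDeriv_extDeriv_apply (hη.contDiffAt (mem_extChartAt_target x)) two_le_infty

theorem extDer_add (hη : SmoothForm η) (hζ : SmoothForm ζ) :
    extDer (η + ζ) = extDer η + extDer ζ := by
  funext x
  rw [Pi.add_apply, extDer_apply, extDer_apply, extDer_apply, chartForm_add]
  exact extDeriv_fun_add (hη.differentiableAt x) (hζ.differentiableAt x)

theorem extDer_smul (c : ℝ) (η : Π x : M, ExtCotangent E n x) :
    extDer (c • η) = c • extDer η := by
  funext x
  rw [Pi.smul_apply, extDer_apply, extDer_apply, chartForm_smul]
  exact extDeriv_smul c _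

theorem lieDer_add (hη : SmoothForm η) (hζ : SmoothForm ζ) :
    lieDer X (η + ζ) = lieDer X η + lieDer X ζ := by
  funext x
  rw [Pi.add_apply, lieDer_apply, lieDer_apply, lieDer_apply, chartForm_add]
  exact lieDerVec_add_form (hη.differentiableAt x) (hζ.differentiableAt x)

theorem lieDer_add_field (hX : SmoothField X) (hY : SmoothField Y) :
    lieDer (X + Y) η = lieDer X η + lieDer Y η := by
  funext x
  rw [Pi.add_apply, lieDer_apply, lieDer_apply, lieDer_apply, chartField_add]
  exact lieDerVec_add_field (hX.differentiableAt x) (hY.differentiableAt x)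

theorem lieDer_eq_of_degree_zero (X : Π x : M, TangentSpace 𝓘(ℝ, E) x)
    (η : Π x : M, ExtCotangent E 0 x) : lieDer X η = iota X (extDer η) := by
  funext x
  rw [lieDer_apply, lieDerVec_zero, chartField_self]
  exact congrArg (fun θ : E [⋀^Fin 1]→L[ℝ] ℝ => θ.curryLeft (X x)) (extDer_apply η x).symm

theorem lieDer_eq_of_degree_succ {η : Π x : M, ExtCotangent E (n + 1) x} (hX : SmoothField X)
    (hη : SmoothForm η) : lieDer X η = extDer (iota X η) + iota X (extDer η) := by
  funext x
  rw [lieDer_apply, lieDerVec_succ (hX.differentiableAt x) (hη.differentiableAt x),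
    chartField_self, Pi.add_apply, extDer_apply,
    (chartForm_iota_eventuallyEq X η x).extDeriv_eq]
  exact congrArg (fun θ : E [⋀^Fin (n + 2)]→L[ℝ] ℝ =>
    (extDeriv (iotaVec (chartField X x) (chartForm η x)) (extChartAt 𝓘(ℝ, E) x x) +
      θ.curryLeft (X x) : E [⋀^Fin (n + 1)]→L[ℝ] ℝ)) (extDer_apply η x).symm

/-- Cartan's formula `L_X = d i_X + i_X d` in all degrees. -/
theorem lieDer_eq (hX : SmoothField X) (hη : SmoothForm η) :
    lieDer X η = extDerPred (interior X η) + iota X (extDer η) := by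
  cases n with
  -- In degree `0` the term `d i_X η` is zero by the conventions for `extDerPred` and `interior`.
  | zero => exact (lieDer_eq_of_degree_zero X η).trans (zero_add _).symm
  | succ n => exact lieDer_eq_of_degree_succ hX hη

theorem SmoothForm.extDerPred_interior (hX : SmoothField X) (hη : SmoothForm η) :
    SmoothForm (extDerPred (interior X η)) := by
  cases n with
  | zero => exact smoothForm_zero
  | succ n => exact (SmoothForm.iota hX hη).extDer

/-- Cartan's formula reduces this to `d` and contractions, whose expressions are known throughout
each chart. -/
theorem SmoothForm.lieDer (hX : SmoothField X) (hη : SmoothForm η) : SmoothForm (lieDer X η) := by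
  rw [lieDer_eq hX hη]
  exact (SmoothForm.extDerPred_interior hX hη).add (SmoothForm.iota hX hη.extDer)

/-- `mlieBracket` is the pullback of the bracket of the chart expressions, and at the base point
that pullback is along the identity. -/
theorem lieBracket_chartField (X Y : Π x : M, TangentSpace 𝓘(ℝ, E) x) (x : M) :
    lieBracket ℝ (chartField X x) (chartField Y x) (extChartAt 𝓘(ℝ, E) x x) =
      mlieBracket 𝓘(ℝ, E) X Y x := by
  have h (Z : Π x : M, TangentSpace 𝓘(ℝ, E) x) : mpullbackWithin 𝓘(ℝ, E) 𝓘(ℝ, E)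
      (extChartAt 𝓘(ℝ, E) x).symm Z (Set.range 𝓘(ℝ, E)) = chartField Z x := by
    simp only [modelWithCornersSelf_coe, Set.range_id, mpullbackWithin_univ]
    rfl
  rw [mlieBracket, mlieBracketWithin_apply, h, h]
  have h1 : (mfderiv 𝓘(ℝ, E) 𝓘(ℝ, E) (extChartAt 𝓘(ℝ, E) x) x : E →L[ℝ] E) =
      ContinuousLinearMap.id ℝ E :=
    (mfderiv_extChartAt_eq (mem_extChartAt_source x)).trans (tangentCoordChange_self_eq_id x)
  have h2 : (mfderiv 𝓘(ℝ, E) 𝓘(ℝ, E) (extChartAt 𝓘(ℝ, E) x) x : E →L[ℝ] E).inverse =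
      ContinuousLinearMap.id ℝ E :=
    (congrArg (fun A : E →L[ℝ] E => A.inverse) h1).trans ContinuousLinearMap.inverse_id
  refine Eq.trans ?_ (congrArg (fun A : E →L[ℝ] E => A _) h2).symm
  simp only [modelWithCornersSelf_coe, Set.range_id, Set.preimage_univ, Set.inter_univ]
  rw [← lieBracketWithin_univ]
  rfl

/-- The formula `[L_X, i_Y] = i_[X, Y]`. -/
theorem lieDer_iota {η : Π x : M, ExtCotangent E (n + 1) x} (hY : SmoothField Y)
    (hη : SmoothForm η) :
    lieDer X (iota Y η) = iota Y (lieDer X η) + iota (mlieBracket 𝓘(ℝ, E) X Y) η := by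
  funext x
  -- The Lie derivative at a point sees only the germ of the form there.
  have h : lieDerVec (chartField X x) (chartForm (iota Y η) x) (extChartAt 𝓘(ℝ, E) x x) =
      lieDerVec (chartField X x) (iotaVec (chartField Y x) (chartForm η x))
        (extChartAt 𝓘(ℝ, E) x x) := by
    rw [lieDerVec, lieDerVec, (chartForm_iota_eventuallyEq Y η x).fderiv_eq,
      (chartForm_iota_eventuallyEq Y η x).eq_of_nhds]
  rw [lieDer_apply, h, lieDerVec_iotaVec (hY.differentiableAt x) (hη.differentiableAt x),
    chartField_self, lieBracket_chartField, chartForm_self]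
  exact congrArg (fun θ : E [⋀^Fin (n + 1)]→L[ℝ] ℝ =>
    (θ.curryLeft (Y x) + ContinuousAlternatingMap.curryLeft
      (show E [⋀^Fin (n + 1)]→L[ℝ] ℝ from η x) (mlieBracket 𝓘(ℝ, E) X Y x) :
      E [⋀^Fin n]→L[ℝ] ℝ)) (lieDer_apply X η x).symm

theorem contDiffOn_comp_symm (hf : ContMDiff 𝓘(ℝ, E) 𝓘(ℝ, ℝ) ∞ f) (x : M) :
    ContDiffOn ℝ ∞ (f ∘ (extChartAt 𝓘(ℝ, E) x).symm) (extChartAt 𝓘(ℝ, E) x).target :=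
  (hf.comp_contMDiffOn (contMDiffOn_extChartAt_symm x)).contDiffOn

theorem differentiableAt_comp_symm (hf : ContMDiff 𝓘(ℝ, E) 𝓘(ℝ, ℝ) ∞ f) (x : M) :
    DifferentiableAt ℝ (f ∘ (extChartAt 𝓘(ℝ, E) x).symm) (extChartAt 𝓘(ℝ, E) x x) :=
  ((contDiffOn_comp_symm hf x).contDiffAt (extChartAt_target_mem_nhds x)).differentiableAt
    (by simp)

theorem SmoothForm.fun_smul (hf : ContMDiff 𝓘(ℝ, E) 𝓘(ℝ, ℝ) ∞ f) (hη : SmoothForm η) :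
    SmoothForm (fun x => f x • η x) :=
  fun x₀ => (contDiffOn_comp_symm hf x₀).smul (hη x₀)

theorem SmoothField.fun_smul (hf : ContMDiff 𝓘(ℝ, E) 𝓘(ℝ, ℝ) ∞ f) (hX : SmoothField X) :
    SmoothField (fun x => f x • X x) := fun x₀ => by
  rw [chartField_fun_smul]
  exact (contDiffOn_comp_symm hf x₀).smul (hX x₀)

/-- The Leibniz rule `d(f ξ) = f dξ + df ∧ ξ` for `ξ = i_X η`. -/
theorem extDerPred_fun_smul_interior (hf : ContMDiff 𝓘(ℝ, E) 𝓘(ℝ, ℝ) ∞ f) (hX : SmoothField X)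
    (hη : SmoothForm η) :
    extDerPred (fun x => f x • interior X η x) =
      (fun x => f x • extDerPred (interior X η) x) + dWedgePred f (interior X η) := by
  cases n with
  | zero => exact (funext fun x => by simp [extDerPred, dWedgePred])
  | succ n =>
    funext x
    have hi : SmoothForm (iota X η) := SmoothForm.iota hX hη
    have h := extDeriv_fun_smul_form (differentiableAt_comp_symm hf x) (hi.differentiableAt x)
    rw [comp_symm_self, chartForm_self, ← mfderiv_eq_fderiv_comp_symm hf] at h
    refine (extDer_apply (fun x => f x • iota X η x) x).trans (h.trans ?_)
    refine congrArg (fun θ : E [⋀^Fin (n + 1)]→L[ℝ] ℝ => f x • θ + _) (extDer_apply _ x).symm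

/-- The Leibniz rule `L_X (f η) = f L_X η + X(f) η`. -/
theorem lieDer_fun_smul (hf : ContMDiff 𝓘(ℝ, E) 𝓘(ℝ, ℝ) ∞ f) (hη : SmoothForm η) :
    lieDer X (fun x => f x • η x) =
      fun x => f x • lieDer X η x + derivAlong X f x • η x := by
  funext x
  have h := lieDerVec_fun_smul_form (X := chartField X x) (differentiableAt_comp_symm hf x)
    (hη.differentiableAt x)
  rw [comp_symm_self, chartForm_self, ← mfderiv_eq_fderiv_comp_symm hf, chartField_self] at h
  refine (lieDer_apply X (fun x => f x • η x) x).trans (h.trans ?_)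
  exact congrArg (fun θ : E [⋀^Fin n]→L[ℝ] ℝ => f x • θ + _) (lieDer_apply X η x).symm

/-- The rule `L_{f X} η = f L_X η + df ∧ i_X η`. -/
theorem lieDer_fun_smul_field (hf : ContMDiff 𝓘(ℝ, E) 𝓘(ℝ, ℝ) ∞ f) (hX : SmoothField X)
    (hη : SmoothForm η) :
    lieDer (fun x => f x • X x) η =
      (fun x => f x • lieDer X η x) + dWedgePred f (interior X η) := by
  funext x
  rw [lieDer_apply, chartField_fun_smul]
  cases n with
  | zero =>
    rw [lieDerVec_fun_smul_field_zero, comp_symm_self]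
    refine Eq.trans ?_ (add_zero _).symm
    exact congrArg (fun θ : E [⋀^Fin 0]→L[ℝ] ℝ => f x • θ) (lieDer_apply X η x).symm
  | succ n =>
    rw [lieDerVec_fun_smul_field_succ (differentiableAt_comp_symm hf x) (hX.differentiableAt x)
      (hη.differentiableAt x), comp_symm_self, chartForm_self, ← mfderiv_eq_fderiv_comp_symm hf,
      chartField_self]
    exact congrArg (fun θ : E [⋀^Fin (n + 1)]→L[ℝ] ℝ => f x • θ + _) (lieDer_apply X η x).symm

end Cartan

/-! ### Tensoriality, commutation relations and the identities of the bracket -/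

section Identities

variable {E : Type*} [NormedAddCommGroup E] [NormedSpace ℝ E]
  {M : Type*} [TopologicalSpace M] [ChartedSpace E M] {n : ℕ}
  {X Y : Π x : M, TangentSpace 𝓘(ℝ, E) x} {η ζ : Π x : M, ExtCotangent E n x} {f : M → ℝ}

theorem iota_add (X : Π x : M, TangentSpace 𝓘(ℝ, E) x) (η ζ : Π x : M, ExtCotangent E (n + 1) x) :
    iota X (η + ζ) = iota X η + iota X ζ := rfl

theorem iota_sub (X : Π x : M, TangentSpace 𝓘(ℝ, E) x) (η ζ : Π x : M, ExtCotangent E (n + 1) x) :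
    iota X (η - ζ) = iota X η - iota X ζ := rfl

theorem iota_zero (X : Π x : M, TangentSpace 𝓘(ℝ, E) x) :
    iota X (0 : Π x : M, ExtCotangent E (n + 1) x) = 0 := rfl

theorem iota_add_field (X Y : Π x : M, TangentSpace 𝓘(ℝ, E) x)
    (η : Π x : M, ExtCotangent E (n + 1) x) : iota (X + Y) η = iota X η + iota Y η :=
  funext fun x => map_add
    (ContinuousAlternatingMap.curryLeft (show E [⋀^Fin (n + 1)]→L[ℝ] ℝ from η x)) (X x) (Y x)

theorem iota_fun_smul_field (f : M → ℝ) (X : Π x : M, TangentSpace 𝓘(ℝ, E) x)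
    (η : Π x : M, ExtCotangent E (n + 1) x) :
    iota (fun x => f x • X x) η = fun x => f x • iota X η x :=
  funext fun x => map_smul
    (ContinuousAlternatingMap.curryLeft (show E [⋀^Fin (n + 1)]→L[ℝ] ℝ from η x)) (f x) (X x)

theorem interior_fun_smul (f : M → ℝ) (X : Π x : M, TangentSpace 𝓘(ℝ, E) x)
    (η : Π x : M, ExtCotangent E n x) :
    interior X (fun x => f x • η x) = fun x => f x • interior X η x := by
  cases n with
  | zero => rfl
  | succ n => rfl

theorem dWedgePred_add (f : M → ℝ) (ξ ξ' : Π x : M, ExtCotangentPred E n x) :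
    dWedgePred f (ξ + ξ') = dWedgePred f ξ + dWedgePred f ξ' := by
  cases n with
  | zero => exact (add_zero _).symm
  | succ n =>
    funext x
    refine Eq.trans (congrArg ContinuousAlternatingMap.alternatizeUncurryFin ?_)
      (ContinuousAlternatingMap.alternatizeUncurryFin_add (E := E) (F := ℝ) (n := n)
        ((show E →L[ℝ] ℝ from mfderiv 𝓘(ℝ, E) 𝓘(ℝ, ℝ) f x).smulRight
          (show E [⋀^Fin n]→L[ℝ] ℝ from ξ x))
        ((show E →L[ℝ] ℝ from mfderiv 𝓘(ℝ, E) 𝓘(ℝ, ℝ) f x).smulRight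
          (show E [⋀^Fin n]→L[ℝ] ℝ from ξ' x)))
    exact ContinuousLinearMap.ext fun v => smul_add
      ((show E →L[ℝ] ℝ from mfderiv 𝓘(ℝ, E) 𝓘(ℝ, ℝ) f x) v)
      (show E [⋀^Fin n]→L[ℝ] ℝ from ξ x) (show E [⋀^Fin n]→L[ℝ] ℝ from ξ' x)

theorem derivAlong_const (X : Π x : M, TangentSpace 𝓘(ℝ, E) x) (c : ℝ) (x : M) :
    derivAlong X (fun _ => c) x = 0 := by
  rw [derivAlong, mfderiv_const]
  rfl

theorem dWedgePred_const (c : ℝ) (ξ : Π x : M, ExtCotangentPred E n x) :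
    dWedgePred (fun _ => c) ξ = 0 := by
  cases n with
  | zero => rfl
  | succ n =>
    funext x
    have h : (mfderiv 𝓘(ℝ, E) 𝓘(ℝ, ℝ) (fun _ : M => c) x : E →L[ℝ] ℝ) = 0 := mfderiv_const
    have h' : (show E →L[ℝ] ℝ from mfderiv 𝓘(ℝ, E) 𝓘(ℝ, ℝ) (fun _ : M => c) x).smulRight
        (show E [⋀^Fin n]→L[ℝ] ℝ from ξ x) = 0 := by
      refine ContinuousLinearMap.ext fun v => ?_
      exact (congrArg (fun A : E →L[ℝ] ℝ => A v • (show E [⋀^Fin n]→L[ℝ] ℝ from ξ x)) h).trans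
        (zero_smul ℝ (show E [⋀^Fin n]→L[ℝ] ℝ from ξ x))
    exact (congrArg ContinuousAlternatingMap.alternatizeUncurryFin h').trans
      (map_zero (ContinuousAlternatingMap.alternatizeUncurryFinCLM ℝ E ℝ (n := n)))

variable {e e₁ e₂ e₃ : Π x : M, HigherTangent E n x}

theorem vec_dorfman (e₁ e₂ : Π x : M, HigherTangent E n x) :
    vec (dorfman e₁ e₂) = mlieBracket 𝓘(ℝ, E) (vec e₁) (vec e₂) := rfl

theorem higherTangent_ext (hv : vec e₁ = vec e₂) (hf : form e₁ = form e₂) : e₁ = e₂ :=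
  funext fun x => Prod.ext (congrFun hv x) (congrFun hf x)

theorem two_smul_pairing (e₁ e₂ : Π x : M, HigherTangent E n x) :
    (2 : ℝ) • pairing e₁ e₂ = interior (vec e₁) (form e₂) + interior (vec e₂) (form e₁) := by
  rw [pairing, smul_smul]
  norm_num

variable [IsManifold 𝓘(ℝ, E) ∞ M]

theorem lieDer_zero : lieDer X (0 : Π x : M, ExtCotangent E n x) = 0 := by
  have h := lieDer_add (X := X) (smoothForm_zero (E := E) (M := M) (n := n)) smoothForm_zero
  rwa [add_zero, left_eq_add] at h

theorem lieDer_sub (hη : SmoothForm η) (hζ : SmoothForm ζ) :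
    lieDer X (η - ζ) = lieDer X η - lieDer X ζ := by
  rw [eq_sub_iff_add_eq, ← lieDer_add (hη.sub hζ) hζ, sub_add_cancel]

theorem extDer_sub (hη : SmoothForm η) (hζ : SmoothForm ζ) :
    extDer (η - ζ) = extDer η - extDer ζ := by
  rw [eq_sub_iff_add_eq, ← extDer_add (hη.sub hζ) hζ, sub_add_cancel]

theorem lieDer_smul (c : ℝ) (hη : SmoothForm η) : lieDer X (c • η) = c • lieDer X η := by
  have h := lieDer_fun_smul (X := X) (contMDiff_const (c := c)) hη
  simp only [derivAlong_const, zero_smul, add_zero] at h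
  exact h

theorem extDer_zero : extDer (0 : Π x : M, ExtCotangent E n x) = 0 := by
  have h := extDer_smul (0 : ℝ) (0 : Π x : M, ExtCotangent E n x)
  rwa [zero_smul, zero_smul] at h

theorem extDer_extDerPred_interior (hX : SmoothField X) (hη : SmoothForm η) :
    extDer (extDerPred (interior X η)) = 0 := by
  cases n with
  | zero => exact extDer_zero
  | succ n => exact extDer_extDer (SmoothForm.iota hX hη)

/-- The Lie derivative commutes with the exterior derivative. -/
theorem lieDer_extDer (hX : SmoothField X) (hη : SmoothForm η) :
    lieDer X (extDer η) = extDer (lieDer X η) := by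
  -- By Cartan's formula and `d² = 0`, both sides equal `d i_X dη`.
  rw [lieDer_eq hX hη, extDer_add (SmoothForm.extDerPred_interior hX hη)
    (SmoothForm.iota hX hη.extDer), extDer_extDerPred_interior hX hη, zero_add,
    lieDer_eq_of_degree_succ hX hη.extDer, extDer_extDer hη, iota_zero, add_zero]

/-- Apply `d` to `[L_X, i_Y] = i_[X,Y]` and commute it past `L_X`; in degree `0` all terms vanish.
-/
theorem lieDer_extDerPred_interior (hX : SmoothField X) (hY : SmoothField Y)
    (hXY : SmoothField (mlieBracket 𝓘(ℝ, E) X Y)) (hη : SmoothForm η) :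
    lieDer X (extDerPred (interior Y η)) = extDerPred (interior Y (lieDer X η)) +
      extDerPred (interior (mlieBracket 𝓘(ℝ, E) X Y) η) := by
  cases n with
  | zero => exact lieDer_zero.trans (add_zero _).symm
  | succ n =>
    have h : lieDer X (extDer (iota Y η)) = extDer (iota Y (lieDer X η)) +
        extDer (iota (mlieBracket 𝓘(ℝ, E) X Y) η) := by
      rw [lieDer_extDer hX (SmoothForm.iota hY hη), lieDer_iota hY hη,
        extDer_add (SmoothForm.iota hY (hη.lieDer hX)) (SmoothForm.iota hXY hη)]
    exact h

/-- The formula `L_[X, Y] = [L_X, L_Y]`. -/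
theorem lieDer_mlieBracket (hX : SmoothField X) (hY : SmoothField Y)
    (hXY : SmoothField (mlieBracket 𝓘(ℝ, E) X Y)) (hη : SmoothForm η) :
    lieDer (mlieBracket 𝓘(ℝ, E) X Y) η = lieDer X (lieDer Y η) - lieDer Y (lieDer X η) := by
  -- Moving `L_X` past `d i_Y` and past `i_Y d` leaves the commutators `d i_[X,Y]` and `i_[X,Y] d`,
  -- which add up to `L_[X,Y]`.
  have h1 : lieDer X (lieDer Y η) = lieDer X (extDerPred (interior Y η)) +
      lieDer X (iota Y (extDer η)) := by
    rw [lieDer_eq hY hη, lieDer_add (SmoothForm.extDerPred_interior hY hη)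
      (SmoothForm.iota hY hη.extDer)]
  rw [h1, lieDer_eq hY (hη.lieDer hX), lieDer_eq hXY hη,
    lieDer_extDerPred_interior hX hY hXY hη, lieDer_iota hY hη.extDer, lieDer_extDer hX hη]
  abel

/-! ### The higher-order Dorfman bracket -/

/-- The trivializations of the direct sum are products of those of its summands. -/
theorem isSmoothSection_higherTangent_iff (e : Π x : M, HigherTangent E n x) :
    IsSmoothSection E (Model E n) e ↔ SmoothField (vec e) ∧ SmoothForm (form e) := by
  rw [← isSmoothSection_iff_smoothField, ← isSmoothSection_iff_smoothForm,
    isSmoothSection_iff_contDiffOn (fun x₀ => Set.inter_self _),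
    isSmoothSection_iff_contDiffOn (fun x₀ => rfl), isSmoothSection_iff_contDiffOn (fun x₀ => rfl),
    ← forall_and]
  exact forall_congr' fun x₀ => ⟨fun h => ⟨h.fst, h.snd⟩, fun h => h.1.prodMk h.2⟩

/-- The bracket costs one derivative, which is harmless at order `∞`. -/
theorem SmoothField.mlieBracket [CompleteSpace E] (hX : SmoothField X) (hY : SmoothField Y) :
    SmoothField (mlieBracket 𝓘(ℝ, E) X Y) := by
  rw [← isSmoothSection_iff_smoothField] at *
  have : IsManifold 𝓘(ℝ, E) (((⊤ : ℕ∞) : WithTop ℕ∞) + 1) M := ‹IsManifold 𝓘(ℝ, E) ∞ M›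
  have : IsManifold 𝓘(ℝ, E) (minSmoothness ℝ 2) M := IsManifold.of_le (n := ∞) two_le_infty
  refine ContDiff.mlieBracket_vectorField (m := ⊤) (n := ⊤) hX hY ?_
  rw [minSmoothness_of_isRCLikeNormedField]
  exact le_rfl

theorem SmoothField.contMDiff (hX : SmoothField X) {m : WithTop ℕ∞} (hm : m ≤ ∞) :
    ContMDiff 𝓘(ℝ, E) 𝓘(ℝ, E).tangent m (fun x => (⟨x, X x⟩ : TangentBundle 𝓘(ℝ, E) M)) :=
  ContMDiff.of_le ((isSmoothSection_iff_smoothField X).2 hX) hm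

theorem SmoothField.mdifferentiableAt (hX : SmoothField X) (x : M) :
    MDifferentiableAt 𝓘(ℝ, E) 𝓘(ℝ, E).tangent
      (fun x => (⟨x, X x⟩ : TangentBundle 𝓘(ℝ, E) M)) x :=
  (hX.contMDiff le_rfl x).mdifferentiableAt (by simp)

/-- The form part of the Dorfman bracket is `L_X β - i_Y dα`. -/
theorem form_dorfman (h₁ : SmoothForm (form e₁)) (h₂ : SmoothField (vec e₂)) :
    form (dorfman e₁ e₂) = lieDer (vec e₁) (form e₂) - iota (vec e₂) (extDer (form e₁)) := by
  have h : form (dorfman e₁ e₂) = lieDer (vec e₁) (form e₂) - lieDer (vec e₂) (form e₁) +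
      extDerPred (interior (vec e₂) (form e₁)) := rfl
  rw [h, lieDer_eq h₂ h₁]
  abel

theorem isSmoothSection_dorfman [CompleteSpace E] (h₁ : IsSmoothSection E (Model E n) e₁)
    (h₂ : IsSmoothSection E (Model E n) e₂) :
    IsSmoothSection E (Model E n) (dorfman e₁ e₂) := by
  rw [isSmoothSection_higherTangent_iff] at *
  refine ⟨h₁.1.mlieBracket h₂.1, ?_⟩
  rw [form_dorfman h₁.2 h₂.1]
  exact (h₂.2.lieDer h₁.1).sub (SmoothForm.iota h₂.1 h₁.2.extDer)

theorem dorfman_leibniz [CompleteSpace E] (h₁ : IsSmoothSection E (Model E n) e₁)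
    (h₂ : IsSmoothSection E (Model E n) e₂) (h₃ : IsSmoothSection E (Model E n) e₃) :
    dorfman e₁ (dorfman e₂ e₃) = dorfman (dorfman e₁ e₂) e₃ + dorfman e₂ (dorfman e₁ e₃) := by
  have h₂₃ := isSmoothSection_dorfman h₂ h₃
  have h₁₃ := isSmoothSection_dorfman h₁ h₃
  have h₁₂ := isSmoothSection_dorfman h₁ h₂
  rw [isSmoothSection_higherTangent_iff] at *
  have : IsManifold 𝓘(ℝ, E) (minSmoothness ℝ 3) M := by
    rw [minSmoothness_of_isRCLikeNormedField]
    exact IsManifold.of_le (n := ∞) ENat.LEInfty.out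
  refine higherTangent_ext ?_ ?_
  · exact leibniz_identity_mlieBracket (h₁.1.contMDiff two_le_infty) (h₂.1.contMDiff two_le_infty)
      (h₃.1.contMDiff two_le_infty)
  · have h : form (dorfman (dorfman e₁ e₂) e₃ + dorfman e₂ (dorfman e₁ e₃)) =
      form (dorfman (dorfman e₁ e₂) e₃) + form (dorfman e₂ (dorfman e₁ e₃)) := rfl
    -- The `γ` terms match by `L_[X,Y] = [L_X, L_Y]`, the `β` terms by commuting `L_X` with `i_Z`
    -- and `d`. For `α`, the term `i_Z d i_Y dα` equals `i_Z L_Y dα` because `d² = 0`, and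
    -- subtracting `L_Y i_Z dα` leaves `-i_[Y,Z] dα`.
    rw [h, form_dorfman h₁.2 h₂₃.1, form_dorfman h₁₂.2 h₃.1, form_dorfman h₂.2 h₁₃.1,
      form_dorfman h₁.2 h₂.1, form_dorfman h₂.2 h₃.1, form_dorfman h₁.2 h₃.1, vec_dorfman,
      vec_dorfman, vec_dorfman, lieDer_mlieBracket h₁.1 h₂.1 h₁₂.1 h₃.2,
      lieDer_sub (h₃.2.lieDer h₂.1) (SmoothForm.iota h₃.1 h₂.2.extDer),
      lieDer_sub (h₃.2.lieDer h₁.1) (SmoothForm.iota h₃.1 h₁.2.extDer),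
      extDer_sub (h₂.2.lieDer h₁.1) (SmoothForm.iota h₂.1 h₁.2.extDer),
      lieDer_iota h₃.1 h₂.2.extDer, lieDer_iota h₃.1 h₁.2.extDer, lieDer_extDer h₁.1 h₂.2,
      lieDer_eq_of_degree_succ h₂.1 h₁.2.extDer, extDer_extDer h₁.2, iota_zero, add_zero, iota_sub]
    abel

theorem dorfman_fun_smul [CompleteSpace E] (h₁ : IsSmoothSection E (Model E n) e₁)
    (h₂ : IsSmoothSection E (Model E n) e₂) (hf : ContMDiff 𝓘(ℝ, E) 𝓘(ℝ, ℝ) ∞ f) :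
    dorfman e₁ (fun x => f x • e₂ x) =
      fun x => f x • dorfman e₁ e₂ x + derivAlong (vec e₁) f x • e₂ x := by
  rw [isSmoothSection_higherTangent_iff] at *
  have : IsManifold 𝓘(ℝ, E) 2 M := IsManifold.of_le (n := ∞) ENat.LEInfty.out
  refine higherTangent_ext ?_ ?_
  · funext x
    refine (mlieBracket_smul_right ((hf x).mdifferentiableAt (by simp))
      (h₂.1.mdifferentiableAt x)).trans (add_comm _ _)
  · have hv : vec (fun x => f x • e₂ x) = fun x => f x • vec e₂ x := rfl
    have hF : form (fun x => f x • e₂ x) = fun x => f x • form e₂ x := rfl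
    rw [form_dorfman (e₂ := fun x => f x • e₂ x) h₁.2 (h₂.1.fun_smul hf), hv, hF,
      lieDer_fun_smul hf h₂.2, iota_fun_smul_field]
    have h : form (fun x => f x • dorfman e₁ e₂ x + derivAlong (vec e₁) f x • e₂ x) =
      fun x => f x • form (dorfman e₁ e₂) x + derivAlong (vec e₁) f x • form e₂ x := rfl
    rw [h, form_dorfman h₁.2 h₂.1]
    funext x
    simp only [Pi.sub_apply, smul_sub]
    abel

/-- The term `Y(f) X` comes from the Lie bracket and `Y(f) α` from `L_Y (f α)`; together they form
`Y(f) e₁`. -/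
theorem fun_smul_dorfman [CompleteSpace E] (h₁ : IsSmoothSection E (Model E n) e₁)
    (h₂ : IsSmoothSection E (Model E n) e₂) (hf : ContMDiff 𝓘(ℝ, E) 𝓘(ℝ, ℝ) ∞ f) :
    dorfman (fun x => f x • e₁ x) e₂ =
      fun x => f x • dorfman e₁ e₂ x - derivAlong (vec e₂) f x • e₁ x +
        ofForm (dWedgePred f ((2 : ℝ) • pairing e₁ e₂)) x := by
  rw [isSmoothSection_higherTangent_iff] at *
  have : IsManifold 𝓘(ℝ, E) 2 M := IsManifold.of_le (n := ∞) ENat.LEInfty.out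
  refine higherTangent_ext ?_ ?_
  · funext x
    refine (mlieBracket_smul_left ((hf x).mdifferentiableAt (by simp))
      (h₁.1.mdifferentiableAt x)).trans ?_
    have h : ∀ a b : TangentSpace 𝓘(ℝ, E) x, ∀ r : ℝ, -r • a + b = b - r • a + 0 := by
      intro a b r
      rw [neg_smul, add_zero, neg_add_eq_sub]
    exact h _ _ _
  -- The original three-term formula is kept instead of `form_dorfman`: in it the two wedge terms
  -- appear directly as the two halves of the pairing.
  · have h : form (dorfman (fun x => f x • e₁ x) e₂) =
        lieDer (fun x => f x • vec e₁ x) (form e₂) - lieDer (vec e₂) (fun x => f x • form e₁ x) +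
          extDerPred (interior (vec e₂) (fun x => f x • form e₁ x)) := rfl
    have h' : form (fun x => f x • dorfman e₁ e₂ x - derivAlong (vec e₂) f x • e₁ x +
        ofForm (dWedgePred f ((2 : ℝ) • pairing e₁ e₂)) x) = fun x =>
        f x • (lieDer (vec e₁) (form e₂) x - lieDer (vec e₂) (form e₁) x +
          extDerPred (interior (vec e₂) (form e₁)) x) - derivAlong (vec e₂) f x • form e₁ x +
        dWedgePred f ((2 : ℝ) • pairing e₁ e₂) x := rfl
    rw [h, h', lieDer_fun_smul_field hf h₁.1 h₂.2, lieDer_fun_smul hf h₁.2, interior_fun_smul,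
      extDerPred_fun_smul_interior hf h₂.1 h₁.2, two_smul_pairing, dWedgePred_add]
    funext x
    simp only [Pi.sub_apply, Pi.add_apply, smul_sub, smul_add]
    abel

theorem pairing_invariant [CompleteSpace E] (h₁ : IsSmoothSection E (Model E n) e₁)
    (h₂ : IsSmoothSection E (Model E n) e₂) (h₃ : IsSmoothSection E (Model E n) e₃) :
    lieDerPred (vec e₁) (pairing e₂ e₃) =
      pairing (dorfman e₁ e₂) e₃ + pairing e₂ (dorfman e₁ e₃) := by
  rw [isSmoothSection_higherTangent_iff] at *
  cases n with
  | zero => rfl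
  | succ n =>
    have h : lieDer (vec e₁) ((1 / 2 : ℝ) • (iota (vec e₂) (form e₃) + iota (vec e₃) (form e₂))) =
        (1 / 2 : ℝ) • (iota (vec (dorfman e₁ e₂)) (form e₃) +
          iota (vec e₃) (form (dorfman e₁ e₂))) +
        (1 / 2 : ℝ) • (iota (vec e₂) (form (dorfman e₁ e₃)) +
          iota (vec (dorfman e₁ e₃)) (form e₂)) := by
      -- The right side contains the extra terms `-i_Z i_Y dα` and `-i_Y i_Z dα`; `iota_iota_swap`
      -- makes them cancel.
      rw [lieDer_smul _ ((SmoothForm.iota h₂.1 h₃.2).add (SmoothForm.iota h₃.1 h₂.2)),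
        lieDer_add (SmoothForm.iota h₂.1 h₃.2) (SmoothForm.iota h₃.1 h₂.2),
        lieDer_iota h₂.1 h₃.2, lieDer_iota h₃.1 h₂.2, form_dorfman h₁.2 h₂.1,
        form_dorfman h₁.2 h₃.1, vec_dorfman, vec_dorfman, iota_sub, iota_sub,
        iota_iota_swap (vec e₂) (vec e₃), ← smul_add]
      congr 1
      abel
    exact h

end Identities

/-! ### The Leibniz algebroid axioms -/

section Algebroid

variable {E : Type*} [NormedAddCommGroup E] [NormedSpace ℝ E]
  {M : Type*} [TopologicalSpace M] [ChartedSpace E M] [IsManifold 𝓘(ℝ, E) ∞ M] {n : ℕ}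
  {e e' e₁ e₂ : Π x : M, HigherTangent E n x}

/-- In trivializations the anchor is the first projection of the model fiber. -/
theorem contMDiff_rho : ContMDiff (𝓘(ℝ, E).prod 𝓘(ℝ, Model E n)) 𝓘(ℝ, E).tangent ∞
    (fun p : TotalSpace (Model E n) (HigherTangent E n : M → _) =>
      (⟨p.1, rho p.1 p.2⟩ : TangentBundle 𝓘(ℝ, E) M)) := by
  intro p
  rw [contMDiffAt_totalSpace]
  refine ⟨contMDiffAt_proj _, ?_⟩
  have h := (contMDiffAt_totalSpace.1 (contMDiffAt_id (I := 𝓘(ℝ, E).prod 𝓘(ℝ, Model E n))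
    (n := ∞) (x := p))).2
  exact (contDiff_fst (𝕜 := ℝ) (E := E) (F := E [⋀^Fin n]→L[ℝ] ℝ)).contMDiff.contMDiffAt.comp p h

theorem add_dorfman [CompleteSpace E] (h : IsSmoothSection E (Model E n) e)
    (h' : IsSmoothSection E (Model E n) e') (h₂ : IsSmoothSection E (Model E n) e₂) :
    dorfman (e + e') e₂ = dorfman e e₂ + dorfman e' e₂ := by
  rw [isSmoothSection_higherTangent_iff] at *
  have : IsManifold 𝓘(ℝ, E) 2 M := IsManifold.of_le (n := ∞) ENat.LEInfty.out
  refine higherTangent_ext ?_ ?_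
  · funext x
    exact mlieBracket_add_left (h.1.mdifferentiableAt x) (h'.1.mdifferentiableAt x)
  · have hv : vec (e + e') = vec e + vec e' := rfl
    have hF : form (e + e') = form e + form e' := rfl
    have hd : form (dorfman e e₂ + dorfman e' e₂) =
      form (dorfman e e₂) + form (dorfman e' e₂) := rfl
    rw [hd, form_dorfman (e₁ := e + e') (h.2.add h'.2) h₂.1, form_dorfman h.2 h₂.1,
      form_dorfman h'.2 h₂.1, hv, hF, lieDer_add_field h.1 h'.1, extDer_add h.2 h'.2, iota_add]
    abel

theorem dorfman_add [CompleteSpace E] (h₁ : IsSmoothSection E (Model E n) e₁)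
    (h : IsSmoothSection E (Model E n) e) (h' : IsSmoothSection E (Model E n) e') :
    dorfman e₁ (e + e') = dorfman e₁ e + dorfman e₁ e' := by
  have hs : IsSmoothSection E (Model E n) (e + e') := by
    rw [isSmoothSection_higherTangent_iff] at *
    exact ⟨fun x₀ => by
      have hv : vec (e + e') = vec e + vec e' := rfl
      rw [hv, chartField_add]
      exact (h.1 x₀).add (h'.1 x₀), h.2.add h'.2⟩
  rw [isSmoothSection_higherTangent_iff] at *
  have : IsManifold 𝓘(ℝ, E) 2 M := IsManifold.of_le (n := ∞) ENat.LEInfty.out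
  refine higherTangent_ext ?_ ?_
  · funext x
    exact mlieBracket_add_right (h.1.mdifferentiableAt x) (h'.1.mdifferentiableAt x)
  · have hv : vec (e + e') = vec e + vec e' := rfl
    have hF : form (e + e') = form e + form e' := rfl
    have hd : form (dorfman e₁ e + dorfman e₁ e') =
      form (dorfman e₁ e) + form (dorfman e₁ e') := rfl
    rw [hd, form_dorfman h₁.2 hs.1, form_dorfman h₁.2 h.1, form_dorfman h₁.2 h'.1, hv, hF,
      lieDer_add h.2 h'.2, iota_add_field]
    abel

/-- A real scalar is a constant function, whose derivative terms in the Leibniz rule vanish. -/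
theorem smul_dorfman [CompleteSpace E] (c : ℝ) (h₁ : IsSmoothSection E (Model E n) e₁)
    (h₂ : IsSmoothSection E (Model E n) e₂) : dorfman (c • e₁) e₂ = c • dorfman e₁ e₂ := by
  refine (fun_smul_dorfman h₁ h₂ (contMDiff_const (c := c))).trans (funext fun x => ?_)
  rw [derivAlong_const, dWedgePred_const, zero_smul, sub_zero]
  exact add_zero _

theorem dorfman_smul [CompleteSpace E] (c : ℝ) (h₁ : IsSmoothSection E (Model E n) e₁)
    (h₂ : IsSmoothSection E (Model E n) e₂) : dorfman e₁ (c • e₂) = c • dorfman e₁ e₂ := by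
  refine (dorfman_fun_smul h₁ h₂ (contMDiff_const (c := c))).trans (funext fun x => ?_)
  rw [derivAlong_const, zero_smul]
  exact add_zero _

theorem isLeibnizAlgebroid_dorfman [CompleteSpace E] :
    IsLeibnizAlgebroid (Model E n)
      (dorfman : (Π x : M, HigherTangent E n x) →
        (Π x : M, HigherTangent E n x) → Π x : M, HigherTangent E n x) rho where
  smooth_anchor := contMDiff_rho
  smooth_bracket _ _ := isSmoothSection_dorfman
  add_bracket _ _ _ := add_dorfman
  bracket_add _ _ _ := dorfman_add
  smul_bracket c _ _ := smul_dorfman c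
  bracket_smul c _ _ := dorfman_smul c
  leibniz _ _ _ := dorfman_leibniz
  anchor_bracket _ _ _ _ := rfl
  bracket_fun_smul _ _ _ := dorfman_fun_smul

end Algebroid

end HigherDorfman

end

theorem mainTheorem2
    {E : Type*} [NormedAddCommGroup E] [NormedSpace ℝ E] [FiniteDimensional ℝ E]
    {M : Type*} [TopologicalSpace M] [ChartedSpace E M] [IsManifold 𝓘(ℝ, E) ∞ M] (n : ℕ) :
    -- (1) the anchored Leibniz rules in both arguments
    (∀ (e₁ e₂ : Π x : M, HigherTangent E n x) (f : M → ℝ),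
      IsSmoothSection E (Model E n) e₁ →
      IsSmoothSection E (Model E n) e₂ →
      ContMDiff 𝓘(ℝ, E) 𝓘(ℝ, ℝ) ∞ f →
      (dorfman e₁ (fun x => f x • e₂ x) =
        fun x => f x • dorfman e₁ e₂ x
          + derivAlong (vec e₁) f x • e₂ x) ∧
      (dorfman (fun x => f x • e₁ x) e₂ =
        fun x => f x • dorfman e₁ e₂ x
          - derivAlong (vec e₂) f x • e₁ x
          + ofForm (dWedgePred f
              ((2 : ℝ) • pairing e₁ e₂)) x)) ∧
    -- (2) the Leibniz identity; consequently, a Leibniz algebroid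
    ((∀ e₁ e₂ e₃ : Π x : M, HigherTangent E n x,
      IsSmoothSection E (Model E n) e₁ →
      IsSmoothSection E (Model E n) e₂ →
      IsSmoothSection E (Model E n) e₃ →
      dorfman e₁ (dorfman e₂ e₃) =
        dorfman (dorfman e₁ e₂) e₃
          + dorfman e₂ (dorfman e₁ e₃)) ∧
      IsLeibnizAlgebroid (Model E n)
        (dorfman : (Π x : M, HigherTangent E n x) →
          (Π x : M, HigherTangent E n x) → Π x : M, HigherTangent E n x)
        rho) ∧
    -- (3) invariance of the pairing
    (∀ e₁ e₂ e₃ : Π x : M, HigherTangent E n x,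
      IsSmoothSection E (Model E n) e₁ →
      IsSmoothSection E (Model E n) e₂ →
      IsSmoothSection E (Model E n) e₃ →
      lieDerPred (vec e₁) (pairing e₂ e₃) =
        pairing (dorfman e₁ e₂) e₃
          + pairing e₂ (dorfman e₁ e₃)) := by
  -- Finite dimension enters only through completeness of the model space.
  have : CompleteSpace E := FiniteDimensional.complete ℝ E
  exact ⟨fun _ _ _ h₁ h₂ hf => ⟨dorfman_fun_smul h₁ h₂ hf, fun_smul_dorfman h₁ h₂ hf⟩,
    ⟨fun _ _ _ => dorfman_leibniz, isLeibnizAlgebroid_dorfman⟩, fun _ _ _ => pairing_invariant⟩
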